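/- **Setting.** A CSP instance $(\Phi,\mathrm{DB})$ consists of finitely many constraints, each with a finite set of variables (its scope) and a finite relation of assignments of that scope; its solutions are the assignments of all its variables whose restriction to each scope lies in the corresponding relation. It is *globally consistent* if every tuple of every constraint relation is the restriction of a solution. Let $d$ be the size of the largest constraint relation. Let $\mathbb D$ be a totally ordered set of weights with a commutative associative operation $\oplus$ that distributes over $\max$. A valuation function is $\mathcal F=f_1\oplus\dots\oplus f_m$ ($m\ge 1$), where each weight function $f_i$ assigns a weight to the assignments of a set $\mathrm{vars}(f_i)$ of variables that is contained in the scope of some constraint. For a set $O$ of variables, MAX$(\Phi_{\mathcal F},O,\mathrm{DB})$ asks for an assignment $\theta$ of $O$ that is the restriction of a solution and such that no other such assignment is strictly better, where $\theta_1\succeq\theta_2$ means that some solution extending $\theta_1$ has a value at least that of every solution extending $\theta_2$; the answer is "no solution" if there is no solution. An *e-join tree* for $\Phi$ is a rooted tree in which each non-leaf vertex has exactly two children, each vertex $v$ is labelled by a constraint (whose scope is denoted $\mathrm{ret}(v)$), each constraint labels some vertex, and variables common to the scopes of two vertices occur in the scope of each vertex on the path between them. Each vertex initially holds the relation of its constraint,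 over the scope $\mathrm{sch}(v)=\mathrm{ret}(v)$; each $f_i$ is attached to one vertex whose scope contains $\mathrm{vars}(f_i)$, and each tuple carries the $\oplus$-sum of the weights attached to its vertex (a neutral value if there are none). The join $\bowtie^\oplus$ combines values by $\oplus$ and the projection $\prod^\oplus$ takes the maximum value. A *shunt operation* on a leaf $l$ with parent $p$, sibling $s$ and grandparent $q$ removes $l$ and $p$ from the tree, makes $s$ (with its subtree) a child of $q$ in place of $p$, and gives $s$ the new scope $\mathrm{ret}(s)\cup(\mathrm{ret}(q)\cap\mathrm{sch}(p))$ and as new relation the projection $\prod^\oplus$ of $\mathrm{rel}(l)\bowtie^\oplus \mathrm{rel}(p)\bowtie^\oplus \mathrm{rel}(s)$ to this scope; the old relation of $s$ is put aside. A *reverse shunt operation* undoes a shunt operation: it selects a tuple of maximum value among the tuples in the join of the relations of $l$, $p$ and the old relation of $s$ that agree with the current relation of $s$, and replaces the relations at $l$, $p$ and $s$ by the restrictions of this tuple (by empty relations if there is none). A DB-machine with $c$ processors performs, in one parallel step, at most $c$ shunt operations (or at most $c$ reverse shunt operations), one per processor, where different processors access disjoint sets of relations; reverse steps undo the shunt steps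 in reverse order. One further kind of step, available once the tree has depth at most one, selects a tuple of maximum value in the join of the relations at the root and its children, and restricts these relations to it. **Statement.** There is an absolute constant $C$ such that the following holds. For every $c\ge 1$ and every e-join tree with $n$ vertices for a constraint formula $\Phi$ there is a program of the DB-machine with $c$ processors, depending only on $c$, the tree and the scopes, that for every globally consistent database and every valuation function as above (however its weight functions are attached) solves MAX$(\Phi_{\mathcal F},O,\mathrm{DB})$ for every set $O$ of variables of $\Phi$: in the end either all vertices of the tree hold empty relations and there is no solution, or there is an assignment $\eta$ such that each vertex holds exactly the restriction of $\eta$ to its scope, and $\eta[O]$ is a correct answer. Moreover: (a) the program consists of at most $$4\left(\lceil \log_2 c\rceil + 2\left\lceil \frac{n}{4c}\right\rceil\right)$$ parallel shunt, reverse shunt and selection steps; (b) the relations stored in the course of the computation are at most $C\,n$ in number (each new content of a register counted), and each of them has at most $C\,d^2$ tuples. -/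

import Mathlib

open scoped Classical

namespace DBMax

/-! ### Assignments, constraint formulas, constraint databases -/

/-- A partial assignment of values in `U` to variables. -/
abbrev Asg (Var U : Type*) := Var → Option U

/-- The restriction `θ[X]`. -/
noncomputable def restrict {Var U : Type*} (X : Finset Var) (θ : Asg Var U) : Asg Var U :=
  fun x => if x ∈ X then θ x else none

/-- `θ` is an assignment of exactly the variables in `X`. -/
def IsOver {Var U : Type*} (X : Finset Var) (θ : Asg Var U) : Prop :=
  ∀ x, (θ x).isSome ↔ x ∈ X

/-- The union of two assignments that agree on their common variables. -/
def union {Var U : Type*} (θ₁ θ₂ : Asg Var U) : Asg Var U :=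
  fun x => (θ₁ x).or (θ₂ x)

/-- A constraint formula: `K` is the set of its constraints (atoms), and each of them has
a scope. -/
structure Formula (Var K : Type*) where
  scope : K → Finset Var

/-- The variables of a formula. -/
noncomputable def Formula.vars {Var K : Type*} [Fintype K] (Φ : Formula Var K) : Finset Var :=
  Finset.univ.biUnion Φ.scope

/-- A constraint database: a finite relation for every constraint. -/
structure Database {Var K : Type*} (Φ : Formula Var K) (U : Type*) where
  rel : K → Finset (Asg Var U)
  isOver : ∀ k, ∀ t ∈ rel k, IsOver (Φ.scope k) t

/-- The size of the largest constraint relation. -/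
def Database.maxSize {Var K U : Type*} [Fintype K] {Φ : Formula Var K} (DB : Database Φ U) : ℕ :=
  Finset.univ.sup fun k => (DB.rel k).card

/-- The solutions of the instance. -/
def solutions {Var K U : Type*} [Fintype K] (Φ : Formula Var K) (DB : Database Φ U) :
    Set (Asg Var U) :=
  {θ | IsOver Φ.vars θ ∧ ∀ k, restrict (Φ.scope k) θ ∈ DB.rel k}

/-- The solutions restricted to the variables in `O`. -/
def solutionsOn {Var K U : Type*} [Fintype K] (Φ : Formula Var K) (DB : Database Φ U)
    (O : Finset Var) : Set (Asg Var U) :=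
  restrict O '' solutions Φ DB

/-- Every tuple of every constraint relation extends to a solution. -/
def GloballyConsistent {Var K U : Type*} [Fintype K] (Φ : Formula Var K)
    (DB : Database Φ U) : Prop :=
  ∀ k, ∀ t ∈ DB.rel k, ∃ θ ∈ solutions Φ DB, restrict (Φ.scope k) θ = t

/-! ### Valuation functions and the problem MAX

The operator `⊕` on the weights is the addition of a commutative semigroup `D`. The type
`WithZero D` adjoins a neutral element `0` to `D`; it is the value of a tuple to which no weight
function applies. On weights the order of `WithZero D` is that of `D`. -/

/-- A weight function: it depends only on the restriction of an assignment to `vars`. -/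
structure WeightFn (Var U D : Type*) where
  vars : Finset Var
  wt : Asg Var U → D

/-- The weight `f(θ) = f(θ[vars f])`. -/
noncomputable def WeightFn.eval {Var U D : Type*} (f : WeightFn Var U D) (θ : Asg Var U) : D :=
  f.wt (restrict f.vars θ)

/-- A valuation function `f₁ ⊕ ⋯ ⊕ fₘ` with `m ≥ 1`. -/
structure Valuation (Var U D : Type*) where
  m : ℕ
  pos : 0 < m
  f : Fin m → WeightFn Var U D

/-- The value of an assignment under a valuation function. -/
noncomputable def Valuation.eval {Var U D : Type*} [AddCommSemigroup D] (F : Valuation Var U D)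
    (θ : Asg Var U) : WithZero D :=
  ∑ i, ((F.f i).eval θ : WithZero D)

/-- The order `θ₁ ≽ θ₂` on the solutions restricted to `O`. -/
def Better {Var K U D : Type*} [Fintype K] [AddCommSemigroup D] [LinearOrder D]
    (Φ : Formula Var K) (DB : Database Φ U) (F : Valuation Var U D) (O : Finset Var)
    (θ₁ θ₂ : Asg Var U) : Prop :=
  ∃ η₁ ∈ solutions Φ DB, restrict O η₁ = θ₁ ∧
    ∀ η₂ ∈ solutions Φ DB, restrict O η₂ = θ₂ → F.eval η₂ ≤ F.eval η₁

/-- The correct answers to the problem MAX; `none` stands for "no solution". -/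
def IsMaxAnswer {Var K U D : Type*} [Fintype K] [AddCommSemigroup D] [LinearOrder D]
    (Φ : Formula Var K) (DB : Database Φ U) (F : Valuation Var U D) (O : Finset Var) :
    Option (Asg Var U) → Prop
  | none => solutions Φ DB = ∅
  | some θ => θ ∈ solutionsOn Φ DB O ∧
      ¬ ∃ θ' ∈ solutionsOn Φ DB O,
        Better Φ DB F O θ' θ ∧ ¬ Better Φ DB F O θ θ'

/-! ### Relations with values, and their relational algebra -/

/-- A relation over a scope, each tuple of which carries a value. -/
structure VRel (Var U D : Type*) where
  scope : Finset Var
  tuples : Finset (Asg Var U)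
  val : Asg Var U → WithZero D

/-- The relation over no variable that holds the empty tuple, with neutral value. -/
noncomputable def VRel.unit (Var U D : Type*) : VRel Var U D where
  scope := ∅
  tuples := {fun _ => none}
  val := fun _ => 0

/-- The pairs of tuples of `R` and `S` that agree on the common variables. -/
noncomputable def VRel.compatible {Var U D : Type*} (R S : VRel Var U D) :
    Finset (Asg Var U × Asg Var U) :=
  (R.tuples ×ˢ S.tuples).filter fun ab => ∀ x ∈ R.scope ∩ S.scope, ab.1 x = ab.2 x

/-- The extended join `R ⋈^⊕ S`. -/
noncomputable def VRel.join {Var U D : Type*} [AddCommSemigroup D] [LinearOrder D]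
    (R S : VRel Var U D) : VRel Var U D where
  scope := R.scope ∪ S.scope
  tuples := (R.compatible S).image fun ab => union ab.1 ab.2
  val := fun θ => ((R.compatible S).filter fun ab => union ab.1 ab.2 = θ).sup
    fun ab => R.val ab.1 + S.val ab.2

/-- The extended projection `Π_X^⊕ R`. -/
noncomputable def VRel.proj {Var U D : Type*} [LinearOrder D] (X : Finset Var)
    (R : VRel Var U D) : VRel Var U D where
  scope := X
  tuples := R.tuples.image (restrict X)
  val := fun θ => (R.tuples.filter fun t => restrict X t = θ).sup R.val

/-- The semijoin `R ⋉ S`. -/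
noncomputable def VRel.semijoin {Var U D : Type*} (R S : VRel Var U D) : VRel Var U D where
  scope := R.scope
  tuples := R.tuples.filter fun t => ∃ t' ∈ S.tuples, ∀ x ∈ R.scope ∩ S.scope, t x = t' x
  val := R.val

/-- Some tuple of maximum value, if there is a tuple. -/
noncomputable def VRel.best {Var U D : Type*} [LinearOrder D] (R : VRel Var U D) :
    Option (Asg Var U) :=
  if h : R.tuples.Nonempty then some (R.tuples.exists_max_image R.val h).choose else none

/-- Only the tuple of `R` that is the restriction of the selected assignment is kept. -/
noncomputable def VRel.keep {Var U D : Type*} (R : VRel Var U D) (η : Option (Asg Var U)) :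
    VRel Var U D where
  scope := R.scope
  tuples := R.tuples.filter fun t => η.map (restrict R.scope) = some t
  val := R.val

/-! ### Strictly binary trees and e-join trees -/

/-- Rooted trees in which every vertex that is not a leaf has a left and a right child. -/
inductive BTree (V : Type*) where
  | leaf : V → BTree V
  | node : V → BTree V → BTree V → BTree V

namespace BTree

variable {V : Type*}

def root : BTree V → V
  | leaf a => a
  | node a _ _ => a

/-- The vertices of the tree. -/
def verts : BTree V → List V
  | leaf a => [a]
  | node a l r => a :: (l.verts ++ r.verts)

/-- The number of vertices. -/
def size (T : BTree V) : ℕ := T.verts.length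

def depth : BTree V → ℕ
  | leaf _ => 0
  | node _ l r => max l.depth r.depth + 1

/-- The vertices of the path from the root to `u`. -/
noncomputable def rootPath : BTree V → V → List V
  | leaf a, _ => [a]
  | node a l r, u =>
      if u = a then [a] else if u ∈ l.verts then a :: l.rootPath u else a :: r.rootPath u

/-- The vertices (possibly repeated) of the path between `u` and `v`. -/
noncomputable def path : BTree V → V → V → List V
  | leaf a, _, _ => [a]
  | node a l r, u, v =>
      if u ∈ l.verts ∧ v ∈ l.verts then l.path u v
      else if u ∈ r.verts ∧ v ∈ r.verts then r.path u v
      else (node a l r).rootPath u ++ (node a l r).rootPath v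

end BTree

/-- A strictly binary e-join tree for a formula: each vertex is an occurrence of a constraint,
each constraint occurs, and the variables common to two vertices occur on the path between
them. -/
structure EJoinTree {Var K : Type*} (Φ : Formula Var K) (V : Type*) where
  tree : BTree V
  con : V → K
  nodup : tree.verts.Nodup
  covers : ∀ k, ∃ v ∈ tree.verts, con v = k
  connected : ∀ u ∈ tree.verts, ∀ v ∈ tree.verts, ∀ w ∈ tree.path u v,
    Φ.scope (con u) ∩ Φ.scope (con v) ⊆ Φ.scope (con w)

/-- The scope of (the constraint at) a vertex. -/
def EJoinTree.sch {Var K V : Type*} {Φ : Formula Var K} (J : EJoinTree Φ V) (v : V) :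
    Finset Var :=
  Φ.scope (J.con v)

/-! ### Shunt operations on trees -/

/-- The vertices involved in a shunt operation on the leaf `l`: its parent `p`, its
sibling `s` and the parent `q` of `p`. -/
structure ShuntOp (V : Type*) where
  l : V
  p : V
  s : V
  q : V

/-- The vertices whose relations a shunt operation reads or writes. -/
noncomputable def ShuntOp.operands {V : Type*} (o : ShuntOp V) : Finset V := {o.l, o.p, o.s}

/-- `Contract T o T'`: the shunt operation `o` turns the tree `T` into `T'`; the vertices `l`
and `p` disappear, and `s` (with the subtree below it) becomes a child of `q` in place of `p`. -/
inductive Contract {V : Type*} : BTree V → ShuntOp V → BTree V → Prop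
  | leftLeft (q p l : V) (S R : BTree V) :
      Contract (.node q (.node p (.leaf l) S) R) ⟨l, p, S.root, q⟩ (.node q S R)
  | leftRight (q p l : V) (S R : BTree V) :
      Contract (.node q (.node p S (.leaf l)) R) ⟨l, p, S.root, q⟩ (.node q S R)
  | rightLeft (q p l : V) (S L : BTree V) :
      Contract (.node q L (.node p (.leaf l) S)) ⟨l, p, S.root, q⟩ (.node q L S)
  | rightRight (q p l : V) (S L : BTree V) :
      Contract (.node q L (.node p S (.leaf l))) ⟨l, p, S.root, q⟩ (.node q L S)
  | inLeft (a : V) {L L' : BTree V} (R : BTree V) {o : ShuntOp V} :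
      Contract L o L' → Contract (.node a L R) o (.node a L' R)
  | inRight (a : V) (L : BTree V) {R R' : BTree V} {o : ShuntOp V} :
      Contract R o R' → Contract (.node a L R) o (.node a L R')

/-- A list of shunt operations turns one tree into another. -/
inductive ContractAll {V : Type*} : BTree V → List (ShuntOp V) → BTree V → Prop
  | nil (T : BTree V) : ContractAll T [] T
  | cons {T T' T'' : BTree V} {o : ShuntOp V} {os : List (ShuntOp V)} :
      Contract T o T' → ContractAll T' os T'' → ContractAll T (o :: os) T''

/-! ### The DB-machine -/

/-- The relation registers: `main v` holds the relation of the tree vertex `v`, and `aux l`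
holds the relation that is put aside by the shunt operation on the leaf `l`. -/
inductive Addr (V : Type*) where
  | main : V → Addr V
  | aux : V → Addr V

/-- A memory; `none` marks a register that is not in use. -/
abbrev Mem (Var U D V : Type*) := Addr V → Option (VRel Var U D)

/-- The contents of a register. -/
noncomputable def Mem.read {Var U D V : Type*} (M : Mem Var U D V) (a : Addr V) : VRel Var U D :=
  (M a).getD (VRel.unit Var U D)

/-- An assignment to a register. -/
noncomputable def Mem.write {Var U D V : Type*} (M : Mem Var U D V) (a : Addr V)
    (R : VRel Var U D) : Mem Var U D V :=
  Function.update M a (some R)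

/-- The effect of a shunt operation on the memory. With `ret v` the original scope of `v`, the
new scope of `s` is `ret s ∪ (ret q ∩ sch p)`, its new relation is the extended projection on
this scope of the join of the relations at `l`, `p` and `s`, and the old relation of `s` is
put aside. (No output variables are propagated.) -/
noncomputable def shuntMem {Var U D V : Type*} [AddCommSemigroup D] [LinearOrder D]
    (ret : V → Finset Var) (M : Mem Var U D V) (o : ShuntOp V) : Mem Var U D V :=
  let l := Mem.read M (.main o.l)
  let p := Mem.read M (.main o.p)
  let s := Mem.read M (.main o.s)
  let s' := ((l.join p).join s).proj (ret o.s ∪ (ret o.q ∩ p.scope))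
  Mem.write (Mem.write M (.aux o.l) s) (.main o.s) s'

/-- The effect of a reverse shunt operation on the memory: a best tuple is selected among the
tuples in the join of the relations of `l`, of `p`, and of the relation of `s` put aside, that
agree with the current relation of `s`; the selected tuples replace the relations at `l`, `p`
and `s`. -/
noncomputable def rshuntMem {Var U D V : Type*} [AddCommSemigroup D] [LinearOrder D]
    (M : Mem Var U D V) (o : ShuntOp V) : Mem Var U D V :=
  let l := Mem.read M (.main o.l)
  let p := Mem.read M (.main o.p)
  let s := Mem.read M (.main o.s)
  let s₀ := Mem.read M (.aux o.l)
  let η := (((l.join p).join s₀).semijoin s).best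
  Mem.write (Mem.write (Mem.write M (.main o.l) (l.keep η)) (.main o.p) (p.keep η))
    (.main o.s) (s₀.keep η)

/-- The join of the relations at the vertices `vs`. -/
noncomputable def joinAll {Var U D V : Type*} [AddCommSemigroup D] [LinearOrder D]
    (M : Mem Var U D V) (vs : List V) : VRel Var U D :=
  vs.foldl (fun R v => R.join (Mem.read M (.main v))) (VRel.unit Var U D)

/-- A best tuple in the join of the relations at the vertices `vs` is selected, and only its
restrictions are kept in these relations. -/
noncomputable def selectMem {Var U D V : Type*} [AddCommSemigroup D] [LinearOrder D]
    (M : Mem Var U D V) (vs : List V) : Mem Var U D V :=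
  vs.foldl (fun N v => Mem.write N (.main v)
    ((Mem.read M (.main v)).keep (joinAll M vs).best)) M

/-- The parallel steps: `shunt` applies the listed shunt operations in parallel, `rshunt`
reverts in parallel the shunt operations of the most recent step that has not been reverted
yet, and `select` selects a best tuple at the root and its children, once the tree has depth at
most one. -/
inductive Instr (V : Type*) where
  | shunt : List (ShuntOp V) → Instr V
  | select : Instr V
  | rshunt : Instr V

/-- A configuration: the current tree, the shunt steps that have not been reverted yet (each
with the tree it was applied to, the most recent one first), and the memory. -/
structure Config (Var U D V : Type*) where
  tree : BTree V
  hist : List (List (ShuntOp V) × BTree V)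
  mem : Mem Var U D V

/-- One parallel step of a DB-machine with `c` processors. Each processor performs at most one
shunt operation (or reverse shunt operation), and different processors access disjoint sets of
relations, so that the result does not depend on the order in which the operations
are listed. -/
inductive Exec {Var U D V : Type*} [AddCommSemigroup D] [LinearOrder D] (c : ℕ)
    (ret : V → Finset Var) : Config Var U D V → Instr V → Config Var U D V → Prop
  | shunt {T T' : BTree V} {H : List (List (ShuntOp V) × BTree V)} {M : Mem Var U D V}
      {os : List (ShuntOp V)} :
      os.length ≤ c →
      os.Pairwise (fun a b => Disjoint a.operands b.operands) →
      ContractAll T os T' →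
      Exec c ret ⟨T, H, M⟩ (.shunt os) ⟨T', (os, T) :: H, os.foldl (shuntMem ret) M⟩
  | select {T : BTree V} {H : List (List (ShuntOp V) × BTree V)} {M : Mem Var U D V} :
      T.depth ≤ 1 →
      Exec c ret ⟨T, H, M⟩ .select ⟨T, H, selectMem M T.verts⟩
  | rshunt {T T₀ : BTree V} {H : List (List (ShuntOp V) × BTree V)} {M : Mem Var U D V}
      {os : List (ShuntOp V)} :
      Exec c ret ⟨T, (os, T₀) :: H, M⟩ .rshunt ⟨T₀, H, os.foldl rshuntMem M⟩

/-- `Run c ret σ prog tr τ`: the program `prog` leads from `σ` to `τ`, and `tr` lists all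
configurations on the way, `σ` and `τ` included. -/
inductive Run {Var U D V : Type*} [AddCommSemigroup D] [LinearOrder D] (c : ℕ)
    (ret : V → Finset Var) :
    Config Var U D V → List (Instr V) → List (Config Var U D V) → Config Var U D V → Prop
  | nil (σ : Config Var U D V) : Run c ret σ [] [σ] σ
  | cons {σ σ' τ : Config Var U D V} {i : Instr V} {is : List (Instr V)}
      {tr : List (Config Var U D V)} :
      Exec c ret σ i σ' → Run c ret σ' is tr τ → Run c ret σ (i :: is) (σ :: tr) τ

/-- The initial configuration: each vertex `v` of the e-join tree holds the relation of its
constraint, and the value of a tuple is the `⊕`-sum of the weight functions that are attached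
to `v` (by `home`), which is neutral if there are none. -/
noncomputable def initial {Var K U D V : Type*} [AddCommSemigroup D] {Φ : Formula Var K}
    (J : EJoinTree Φ V) (DB : Database Φ U) (F : Valuation Var U D) (home : Fin F.m → V) :
    Config Var U D V where
  tree := J.tree
  hist := []
  mem := fun
    | .main v =>
        if v ∈ J.tree.verts then
          some
            { scope := J.sch v
              tuples := DB.rel (J.con v)
              val := fun t =>
                ∑ i ∈ Finset.univ.filter (fun i => home i = v), ((F.f i).eval t : WithZero D) }
        else none
    | .aux _ => none

/-- The answer that a memory encodes: "no solution" if the relations at the tree vertices are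
empty, and `η[O]` if they consist of one tuple each, namely the restriction to the scope of the
vertex of one assignment `η` of all variables. -/
def Outputs {Var K U D V : Type*} [Fintype K] {Φ : Formula Var K} (J : EJoinTree Φ V)
    (O : Finset Var) (M : Mem Var U D V) : Option (Asg Var U) → Prop
  | none => ∀ v ∈ J.tree.verts, ∃ R, M (.main v) = some R ∧ R.tuples = ∅
  | some θ => ∃ η : Asg Var U, IsOver Φ.vars η ∧ restrict O η = θ ∧
      ∀ v ∈ J.tree.verts, ∃ R, M (.main v) = some R ∧ R.scope = J.sch v ∧
        R.tuples = {restrict (J.sch v) η}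

/-- All relations that are stored, at some time, in some register. -/
def storedRelations {Var U D V : Type*} (tr : List (Config Var U D V)) :
    Set (Addr V × VRel Var U D) :=
  {x | ∃ σ ∈ tr, σ.mem x.1 = some x.2}

end DBMax

/-! The argument is bucket elimination carried out by parallel tree contraction, followed by a
replay in reverse.

Correctness. Because variables shared by two vertices occur along the path between them, every
variable that links `l`, `p`, `s` to the rest of the tree lies in the new scope `ret s ∪ (ret q ∩
sch p)` (`Good.mem_shuntScope`). Projecting the join to this scope with maximal values therefore
loses nothing. Solutions survive a shunt with no smaller value (`Good.totalWeight_le_shunt`), and a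
solution of the contracted tree glues with a best matching tuple of the join to a solution of the
old tree that is at least as good (`Good.exists_sol`). A best solution of the contracted tree thus
yields a best solution of the old one, and this is what a reverse shunt computes (`Post.rshunt`). On
the final small tree a best tuple of the full join is a best solution (`Good.post_select`).

Maximising before adding requires `⊕` to be monotone. The neutral value is the least element of
`WithZero D`, so monotonicity fails when a neutral value is compared with a weight. The invariant
`Homog` excludes such mixtures.

Sizes. The scope of a vertex stays inside its original scope together with that of its current
parent, and a tuple is determined by its restrictions to these two parts. Both restrictions stem
from original relations, which gives `d ^ 2` (`Good.shunt`). Global consistency supplies the part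
belonging to the parent at the start.

Time. A tree with `ℓ` leaves admits at least `⌊ℓ/3⌋` shunts with disjoint operands
(`exists_disjoint_shunts`). While `ℓ > 2c`, a step removes at least `c/2` leaves; afterwards two
steps halve the excess over two leaves. Since `n + 1 = 2ℓ`, the stated bound follows
(`exists_schedule`). Each shunt and its reversal cause five register assignments and remove two
vertices, so the number of stored relations is linear (`exists_run`). -/

namespace DBMax

/-! ### Trees and their contractions -/

namespace BTree

variable {V : Type*}

/-- The number of leaves. -/
def leaves : BTree V → ℕ
  | leaf _ => 1
  | node _ l r => l.leaves + r.leaves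

theorem one_le_leaves : ∀ T : BTree V, 1 ≤ T.leaves
  | leaf _ => le_rfl
  | node _ l r => by have := l.one_le_leaves; simp only [leaves]; omega

theorem size_add_one : ∀ T : BTree V, T.size + 1 = 2 * T.leaves
  | leaf _ => rfl
  | node _ l r => by
      have hl := l.size_add_one
      have hr := r.size_add_one
      simp only [size, verts, leaves, List.length_cons, List.length_append] at *
      omega

theorem root_mem_verts : ∀ T : BTree V, T.root ∈ T.verts
  | leaf _ => by simp [root, verts]
  | node _ _ _ => by simp [root, verts]

theorem depth_eq_zero_of_leaves : ∀ T : BTree V, T.leaves ≤ 1 → T.depth = 0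
  | leaf _, _ => rfl
  | node _ l r, h => by
      have := l.one_le_leaves
      have := r.one_le_leaves
      simp only [leaves] at h
      omega

theorem depth_le_one_of_leaves : ∀ T : BTree V, T.leaves ≤ 2 → T.depth ≤ 1
  | leaf _, _ => by simp [depth]
  | node _ l r, h => by
      have := l.one_le_leaves
      have := r.one_le_leaves
      simp only [leaves] at h
      simp [depth, l.depth_eq_zero_of_leaves (by omega), r.depth_eq_zero_of_leaves (by omega)]

/-- `Child T v w`: in the tree `T` the vertex `v` is a child of `w`. -/
inductive Child : BTree V → V → V → Prop
  | left (a : V) (L R : BTree V) : Child (node a L R) L.root a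
  | right (a : V) (L R : BTree V) : Child (node a L R) R.root a
  | inLeft (a : V) {L : BTree V} (R : BTree V) {v w : V} : Child L v w → Child (node a L R) v w
  | inRight (a : V) (L : BTree V) {R : BTree V} {v w : V} : Child R v w → Child (node a L R) v w

theorem child_node {a : V} {L R : BTree V} {v w : V} :
    Child (node a L R) v w ↔
      (v = L.root ∧ w = a) ∨ (v = R.root ∧ w = a) ∨ Child L v w ∨ Child R v w := by
  constructor
  · rintro (_ | _ | h | h) <;> simp_all
  · rintro (⟨rfl, rfl⟩ | ⟨rfl, rfl⟩ | h | h)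
    exacts [.left _ _ _, .right _ _ _, .inLeft _ _ h, .inRight _ _ h]

theorem not_child_leaf {a v w : V} : ¬ Child (leaf a) v w := nofun

theorem Child.mem_verts {T : BTree V} {v w : V} (h : Child T v w) :
    v ∈ T.verts ∧ w ∈ T.verts := by
  induction h with
  | left a L R => simp [verts, root_mem_verts]
  | right a L R => simp [verts, root_mem_verts]
  | inLeft a R _ ih => simp [verts, ih]
  | inRight a L _ ih => simp [verts, ih]

theorem Child.ne_root {T : BTree V} {v w : V} (h : Child T v w) (hT : T.verts.Nodup) :
    v ≠ T.root := by
  cases T with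
  | leaf a => exact (not_child_leaf h).elim
  | node a L R =>
    simp only [verts, List.nodup_cons, List.mem_append, not_or] at hT
    have hL : v ∈ L.verts ∨ v ∈ R.verts := by
      rcases child_node.1 h with ⟨rfl, -⟩ | ⟨rfl, -⟩ | h | h
      exacts [.inl L.root_mem_verts, .inr R.root_mem_verts, .inl h.mem_verts.1, .inr h.mem_verts.1]
    intro hv
    change v = a at hv
    subst hv
    tauto

theorem Child.unique {T : BTree V} {v w w' : V} (hT : T.verts.Nodup) (h : Child T v w)
    (h' : Child T v w') : w = w' := by
  induction T with
  | leaf a => exact (not_child_leaf h).elim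
  | node a L R ihL ihR =>
    simp only [verts, List.nodup_cons, List.nodup_append] at hT
    have key : ∀ {w}, Child (node a L R) v w →
        (v ∈ L.verts ∧ ((v = L.root ∧ w = a) ∨ (v ≠ L.root ∧ Child L v w))) ∨
        (v ∈ R.verts ∧ ((v = R.root ∧ w = a) ∨ (v ≠ R.root ∧ Child R v w))) := by
      intro w h
      rcases child_node.1 h with ⟨rfl, rfl⟩ | ⟨rfl, rfl⟩ | h | h
      · exact .inl ⟨L.root_mem_verts, .inl ⟨rfl, rfl⟩⟩
      · exact .inr ⟨R.root_mem_verts, .inl ⟨rfl, rfl⟩⟩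
      · exact .inl ⟨h.mem_verts.1, .inr ⟨h.ne_root hT.2.1, h⟩⟩
      · exact .inr ⟨h.mem_verts.1, .inr ⟨h.ne_root hT.2.2.1, h⟩⟩
    have h1 := ihL hT.2.1
    have h2 := ihR hT.2.2.1
    have h3 := hT.2.2.2 v
    have h4 := key h
    have h5 := key h'
    grind

theorem exists_parent {T : BTree V} {v : V} (hv : v ∈ T.verts) (hne : v ≠ T.root) :
    ∃ w ∈ T.verts, Child T v w := by
  induction T with
  | leaf a => simp_all [verts, root]
  | node a L R ihL ihR =>
    simp only [verts, List.mem_cons, List.mem_append, root] at hv hne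
    suffices ∃ w, Child (node a L R) v w from
      let ⟨w, hw⟩ := this; ⟨w, hw.mem_verts.2, hw⟩
    rcases hv with hv | hv | hv
    · exact absurd hv hne
    · by_cases h : v = L.root
      · exact ⟨a, h ▸ .left _ _ _⟩
      · obtain ⟨w, -, hw⟩ := ihL hv h
        exact ⟨w, .inLeft _ _ hw⟩
    · by_cases h : v = R.root
      · exact ⟨a, h ▸ .right _ _ _⟩
      · obtain ⟨w, -, hw⟩ := ihR hv h
        exact ⟨w, .inRight _ _ hw⟩

/-- The variables common to two vertices occur on the path between them, stated by recursion
on the tree. -/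
def Separated {Var : Type*} (ret : V → Finset Var) : BTree V → Prop
  | leaf _ => True
  | node a L R =>
      (∀ u ∈ L.verts, ∀ x ∈ ret u, x ∈ ret a → x ∈ ret L.root) ∧
      (∀ u ∈ R.verts, ∀ x ∈ ret u, x ∈ ret a → x ∈ ret R.root) ∧
      (∀ u ∈ L.verts, ∀ v ∈ R.verts, ∀ x ∈ ret u, x ∈ ret v → x ∈ ret a) ∧
      L.Separated ret ∧ R.Separated ret

theorem root_mem_rootPath (u : V) : ∀ T : BTree V, T.root ∈ T.rootPath u
  | leaf a => by simp [root, rootPath]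
  | node a L R => by simp only [root, rootPath]; split_ifs <;> simp

/-- The path from a vertex below a child of `a` to `a` meets that child, and a path between the two
subtrees meets `a`. These instances of connectedness, taken at every vertex, are the recursive
clauses, which suit inductions on the tree. -/
theorem separated_of_path {Var : Type*} {ret : V → Finset Var} :
    ∀ {T : BTree V}, T.verts.Nodup →
      (∀ u ∈ T.verts, ∀ v ∈ T.verts, ∀ w ∈ T.path u v, ret u ∩ ret v ⊆ ret w) →
      T.Separated ret
  | leaf _, _, _ => trivial
  | node a L R, hT, h => by
      simp only [verts, List.nodup_cons, List.mem_append, not_or, List.nodup_append] at hT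
      obtain ⟨⟨haL, haR⟩, hL, hR, hLR⟩ := hT
      have hdis : ∀ u, u ∈ L.verts → u ∉ R.verts := fun u h1 h2 => hLR u h1 u h2 rfl
      simp only [verts, List.mem_cons, List.mem_append] at h
      refine ⟨fun u hu x hx hxa => ?_, fun u hu x hx hxa => ?_, fun u hu v hv x hx hxv => ?_,
        separated_of_path hL fun u hu v hv w hw => ?_,
        separated_of_path hR fun u hu v hv w hw => ?_⟩
      · refine h u (.inr (.inl hu)) a (.inl rfl) L.root ?_ (Finset.mem_inter.2 ⟨hx, hxa⟩)
        have : u ≠ a := by rintro rfl; exact haL hu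
        simp [path, haL, haR, rootPath, this, hu, root_mem_rootPath]
      · refine h u (.inr (.inr hu)) a (.inl rfl) R.root ?_ (Finset.mem_inter.2 ⟨hx, hxa⟩)
        have : u ≠ a := by rintro rfl; exact haR hu
        have : u ∉ L.verts := fun h => hdis u h hu
        simp [path, rootPath, *, root_mem_rootPath]
      · refine h u (.inr (.inl hu)) v (.inr (.inr hv)) a ?_ (Finset.mem_inter.2 ⟨hx, hxv⟩)
        have h1 : v ∉ L.verts := fun h => hdis v h hv
        have h2 := hdis u hu
        simp only [path, h1, h2, and_false, false_and, if_false, List.mem_append]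
        exact .inl (root_mem_rootPath u (node a L R))
      · refine h u (.inr (.inl hu)) v (.inr (.inl hv)) w ?_
        simpa [path, hu, hv] using hw
      · refine h u (.inr (.inr hu)) v (.inr (.inr hv)) w ?_
        have h1 : u ∉ L.verts := fun h => hdis u h hu
        simpa [path, hu, hv, h1] using hw

end BTree

open BTree

variable {V : Type*}

/-! ### The effect of one shunt on vertices, parents and connectedness. -/

theorem Contract.perm {T T' : BTree V} {o : ShuntOp V} (h : Contract T o T') :
    T.verts.Perm (o.l :: o.p :: T'.verts) := by
  induction h with
  | leftLeft | leftRight | rightLeft | rightRight =>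
    -- As an equality of multisets the permutation becomes an additive identity, within reach of
    -- `abel`.
    rw [← Multiset.coe_eq_coe]
    simp only [verts, ← Multiset.cons_coe, ← Multiset.coe_add, List.append_assoc, List.cons_append,
      ← Multiset.singleton_add, Multiset.coe_nil]
    abel
  | inLeft a R _ ih | inRight a L _ ih =>
    rw [← Multiset.coe_eq_coe] at ih ⊢
    simp only [verts, ← Multiset.cons_coe, ← Multiset.coe_add,
      ← Multiset.singleton_add] at ih ⊢
    rw [ih]
    abel

theorem Contract.root_eq {T T' : BTree V} {o : ShuntOp V} (h : Contract T o T') :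
    T'.root = T.root := by
  cases h <;> rfl

theorem Contract.mem_verts_iff {T T' : BTree V} {o : ShuntOp V} (h : Contract T o T') {v : V} :
    v ∈ T.verts ↔ v = o.l ∨ v = o.p ∨ v ∈ T'.verts := by
  rw [h.perm.mem_iff]; simp

theorem Contract.subset {T T' : BTree V} {o : ShuntOp V} (h : Contract T o T') {v : V}
    (hv : v ∈ T'.verts) : v ∈ T.verts :=
  h.mem_verts_iff.2 (.inr (.inr hv))

theorem Contract.nodup {T T' : BTree V} {o : ShuntOp V} (h : Contract T o T')
    (hT : T.verts.Nodup) : o.l ≠ o.p ∧ o.l ∉ T'.verts ∧ o.p ∉ T'.verts ∧ T'.verts.Nodup := by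
  have := h.perm.nodup_iff.1 hT
  simp only [List.nodup_cons, List.mem_cons, not_or] at this
  tauto

theorem Contract.leaves {T T' : BTree V} {o : ShuntOp V} (h : Contract T o T') :
    T.leaves = T'.leaves + 1 := by
  have h1 := h.perm.length_eq
  have h2 := T.size_add_one
  have h3 := T'.size_add_one
  simp only [List.length_cons, BTree.size] at *
  omega

theorem Contract.s_mem {T T' : BTree V} {o : ShuntOp V} (h : Contract T o T') :
    o.s ∈ T'.verts := by
  induction h <;> simp_all [verts, root_mem_verts]

theorem Contract.child {T T' : BTree V} {o : ShuntOp V} (h : Contract T o T') :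
    Child T o.p o.q ∧ Child T o.l o.p ∧ Child T o.s o.p := by
  induction h with
  | leftLeft q p l S R => exact ⟨.left _ _ _, .inLeft _ _ (.left _ _ _), .inLeft _ _ (.right _ _ _)⟩
  | leftRight q p l S R =>
    exact ⟨.left _ _ _, .inLeft _ _ (.right _ _ _), .inLeft _ _ (.left _ _ _)⟩
  | rightLeft q p l S R =>
    exact ⟨.right _ _ _, .inRight _ _ (.left _ _ _), .inRight _ _ (.right _ _ _)⟩
  | rightRight q p l S R =>
    exact ⟨.right _ _ _, .inRight _ _ (.right _ _ _), .inRight _ _ (.left _ _ _)⟩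
  | inLeft a R _ ih => exact ⟨.inLeft _ _ ih.1, .inLeft _ _ ih.2.1, .inLeft _ _ ih.2.2⟩
  | inRight a R _ ih => exact ⟨.inRight _ _ ih.1, .inRight _ _ ih.2.1, .inRight _ _ ih.2.2⟩

theorem Contract.child_new {T T' : BTree V} {o : ShuntOp V} (h : Contract T o T') :
    Child T' o.s o.q := by
  induction h with
  | leftLeft | leftRight => exact .left _ _ _
  | rightLeft | rightRight => exact .right _ _ _
  | inLeft a R _ ih => exact .inLeft _ _ ih
  | inRight a R _ ih => exact .inRight _ _ ih

/-- Only `s` gets a new parent, so every statement about a vertex and its parent needs checking at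
the pair `s`, `q` only. -/
theorem Contract.child_cases {T T' : BTree V} {o : ShuntOp V} (h : Contract T o T')
    (hT : T.verts.Nodup) {v w : V} (hv : Child T' v w) :
    (v = o.s ∧ w = o.q) ∨ (v ≠ o.s ∧ Child T v w) := by
  by_cases hs : v = o.s
  · subst hs
    exact .inl ⟨rfl, hv.unique (h.nodup hT).2.2.2 h.child_new⟩
  · refine .inr ⟨hs, ?_⟩
    clear hT
    induction h with
    | leftLeft | leftRight | rightLeft | rightRight =>
      simp only [child_node, not_child_leaf] at hv hs ⊢
      tauto
    | inLeft a R h ih | inRight a R h ih =>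
      have := h.root_eq
      simp only [child_node] at hv ⊢
      rcases hv with hv | hv | hv | hv <;> simp_all

theorem Contract.separated {Var : Type*} {ret : V → Finset Var} {T T' : BTree V} {o : ShuntOp V}
    (h : Contract T o T') (hT : T.Separated ret) : T'.Separated ret := by
  induction h with
  | leftLeft | leftRight | rightLeft | rightRight =>
    simp only [Separated, verts, root, List.mem_cons, List.mem_append] at hT ⊢
    grind
  | inLeft a R h ih | inRight a L h ih =>
    have h1 := h.root_eq
    have h2 := fun v => h.subset (v := v)
    simp only [Separated] at hT ⊢
    grind

/-- Before the contraction, `p` lies between `s` and `q`. -/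
theorem Contract.ret_s_q {Var : Type*} {ret : V → Finset Var} {T T' : BTree V} {o : ShuntOp V}
    (h : Contract T o T') (hT : T.Separated ret) {x : Var} (hs : x ∈ ret o.s) (hq : x ∈ ret o.q) :
    x ∈ ret o.p := by
  induction h with
  | leftLeft q p l S R | leftRight q p l S R | rightLeft q p l S R | rightRight q p l S R =>
    have := S.root_mem_verts
    simp only [Separated, verts, root, List.mem_cons, List.mem_append] at hT ⊢
    grind
  | inLeft a R h ih => exact ih hT.2.2.2.1 hs hq
  | inRight a L h ih => exact ih hT.2.2.2.2 hs hq

/-- A path from a removed vertex to a remaining one leaves `{l, p}` at `p`, and its next vertex is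
`s` or `q`. -/
theorem Contract.ret_cases {Var : Type*} {ret : V → Finset Var} {T T' : BTree V} {o : ShuntOp V}
    (h : Contract T o T') (hT : T.Separated ret) {x : Var} {y z : V}
    (hy : y = o.l ∨ y = o.p) (hz : z ∈ T'.verts) (hxy : x ∈ ret y) (hxz : x ∈ ret z) :
    x ∈ ret o.s ∨ (x ∈ ret o.p ∧ x ∈ ret o.q) := by
  induction h generalizing z with
  | leftLeft q p l S R | leftRight q p l S R | rightLeft q p l S R | rightRight q p l S R =>
    simp only [Separated, verts, root, List.mem_cons, List.mem_append] at hT hz hy ⊢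
    grind
  | inLeft a R h ih =>
    have hroot := h.root_eq
    have hyL := (h.mem_verts_iff (v := y)).2 (by tauto)
    have hmem := BTree.root_mem_verts (V := V)
    simp only [Separated, verts, List.mem_cons, List.mem_append] at hT hz
    grind
  | inRight a L h ih =>
    have hroot := h.root_eq
    have hyL := (h.mem_verts_iff (v := y)).2 (by tauto)
    have hmem := BTree.root_mem_verts (V := V)
    simp only [Separated, verts, List.mem_cons, List.mem_append] at hT hz
    grind

/-! ### Many disjoint shunt operations -/

theorem ContractAll.append {T T' T'' : BTree V} {os os' : List (ShuntOp V)}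
    (h : ContractAll T os T') (h' : ContractAll T' os' T'') : ContractAll T (os ++ os') T'' := by
  induction h with
  | nil => exact h'
  | cons h1 _ ih => exact .cons h1 (ih h')

theorem ContractAll.inLeft (a : V) {T T' : BTree V} (R : BTree V) {os : List (ShuntOp V)}
    (h : ContractAll T os T') : ContractAll (node a T R) os (node a T' R) := by
  induction h with
  | nil => exact .nil _
  | cons h1 _ ih => exact .cons (.inLeft _ _ h1) ih

theorem ContractAll.inRight (a : V) {T T' : BTree V} (L : BTree V) {os : List (ShuntOp V)}
    (h : ContractAll T os T') : ContractAll (node a L T) os (node a L T') := by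
  induction h with
  | nil => exact .nil _
  | cons h1 _ ih => exact .cons (.inRight _ _ h1) ih

theorem ContractAll.leaves {T T' : BTree V} {os : List (ShuntOp V)} (h : ContractAll T os T') :
    T.leaves = T'.leaves + os.length := by
  induction h with
  | nil => simp
  | cons h1 _ ih => rw [h1.leaves, ih, List.length_cons]; omega

theorem ContractAll.take {T T' : BTree V} {os : List (ShuntOp V)} (h : ContractAll T os T')
    (k : ℕ) : ∃ T'', ContractAll T (os.take k) T'' := by
  induction h generalizing k with
  | nil T => exact ⟨T, by simpa using .nil T⟩
  | @cons T _ _ _ _ h1 _ ih =>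
    cases k with
    | zero => exact ⟨T, .nil T⟩
    | succ k =>
      obtain ⟨T'', h⟩ := ih k
      exact ⟨T'', .cons h1 h⟩

theorem pairwise_disjoint_append {os os' : List (ShuntOp V)} {A A' : V → Prop}
    (h : os.Pairwise fun a b => Disjoint a.operands b.operands)
    (h' : os'.Pairwise fun a b => Disjoint a.operands b.operands)
    (hA : ∀ o ∈ os, ∀ x ∈ o.operands, A x) (hA' : ∀ o ∈ os', ∀ x ∈ o.operands, A' x)
    (hd : ∀ x, A x → ¬ A' x) :
    (os ++ os').Pairwise fun a b => Disjoint a.operands b.operands :=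
  List.pairwise_append.2 ⟨h, h', fun a ha b hb => Finset.disjoint_left.2 fun x hx hx' =>
    hd x (hA a ha x hx) (hA' b hb x hx')⟩

/-- A shunt of a leaf `l` below `a` can follow shunts inside the sibling subtree `S` as long as
these spare the root of `S`, since that root is the only vertex of `S` among its operands. -/
theorem pairwise_disjoint_concat {S S' : BTree V} {os : List (ShuntOp V)} {l a : V} (q : V)
    (haS : a ∉ S.verts) (hlS : l ∉ S.verts) (hr : S'.root = S.root)
    (hm : ∀ o ∈ os, ∀ x ∈ o.operands, x ∈ S.verts ∧ x ≠ S.root)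
    (hp : os.Pairwise fun a b => Disjoint a.operands b.operands) :
    (∀ o ∈ os ++ [⟨l, a, S'.root, q⟩], ∀ x ∈ o.operands, x = l ∨ x = a ∨ x ∈ S.verts) ∧
      (os ++ [(⟨l, a, S'.root, q⟩ : ShuntOp V)]).Pairwise
        (fun a b : ShuntOp V => Disjoint a.operands b.operands) := by
  have hm' : ∀ o ∈ [(⟨l, a, S'.root, q⟩ : ShuntOp V)], ∀ x ∈ o.operands,
      x = l ∨ x = a ∨ x = S.root := by
    intro o ho x hx
    rw [List.mem_singleton.1 ho] at hx
    simpa [ShuntOp.operands, hr] using hx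
  refine ⟨fun o ho x hx => ?_,
    pairwise_disjoint_append hp (List.pairwise_singleton _ _) hm hm' ?_⟩
  · rcases List.mem_append.1 ho with ho | ho
    · exact .inr (.inr (hm o ho x hx).1)
    · exact (hm' o ho x hx).imp_right (Or.imp_right fun h : x = S.root => by
        rw [h]; exact S.root_mem_verts)
  · rintro x ⟨h1, h2⟩ (h | h | h)
    exacts [hlS (h ▸ h1), haS (h ▸ h1), h2 h]

/-- Disjoint shunt operations in a tree, in number at least a third of the number of leaves minus
two if the root must not be an operand, and at least a third of the number of leaves if the root
may be an operand and has a parent `q`. -/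
theorem exists_disjoint_shunts_aux (T : BTree V) (hT : T.verts.Nodup) :
    (∃ os T', ContractAll T os T' ∧ T'.root = T.root ∧
      (∀ o ∈ os, ∀ x ∈ o.operands, x ∈ T.verts ∧ x ≠ T.root) ∧
      os.Pairwise (fun a b => Disjoint a.operands b.operands) ∧ T.leaves ≤ 3 * os.length + 2) ∧
    (2 ≤ T.leaves → ∀ q, ∃ os S,
      (∀ R, ContractAll (node q T R) os (node q S R) ∧ ContractAll (node q R T) os (node q R S)) ∧
      (∀ o ∈ os, ∀ x ∈ o.operands, x ∈ T.verts) ∧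
      os.Pairwise (fun a b => Disjoint a.operands b.operands) ∧ T.leaves ≤ 3 * os.length) := by
  induction T with
  | leaf a =>
    refine ⟨⟨[], leaf a, .nil _, rfl, by simp, by simp, by simp [BTree.leaves]⟩, ?_⟩
    simp [BTree.leaves]
  | node a L R ihL ihR =>
    simp only [verts, List.nodup_cons, List.mem_append, not_or, List.nodup_append] at hT
    obtain ⟨⟨haL, haR⟩, hL, hR, hLR⟩ := hT
    have hdis : ∀ u, u ∈ L.verts → u ∉ R.verts := fun u h1 h2 => hLR u h1 u h2 rfl
    -- With `a` as the parent `q`, the second claim applies to both subtrees. The vertex `q` is not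
    -- an operand, so `a` remains free and the two families are disjoint; no rounding loss occurs.
    have both : 2 ≤ L.leaves → 2 ≤ R.leaves → ∃ os L' R',
        ContractAll (node a L R) os (node a L' R') ∧
        (∀ o ∈ os, ∀ x ∈ o.operands, x ∈ L.verts ∨ x ∈ R.verts) ∧
        os.Pairwise (fun a b => Disjoint a.operands b.operands) ∧
        L.leaves + R.leaves ≤ 3 * os.length := by
      intro h2L h2R
      obtain ⟨os₁, L', hc₁, hm₁, hp₁, hn₁⟩ := (ihL hL).2 h2L a
      obtain ⟨os₂, R', hc₂, hm₂, hp₂, hn₂⟩ := (ihR hR).2 h2R a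
      refine ⟨os₁ ++ os₂, L', R', (hc₁ R).1.append (hc₂ L').2, ?_,
        pairwise_disjoint_append hp₁ hp₂ hm₁ hm₂ hdis, ?_⟩
      · intro o ho x hx
        rcases List.mem_append.1 ho with ho | ho
        exacts [.inl (hm₁ o ho x hx), .inr (hm₂ o ho x hx)]
      · rw [List.length_append]; omega
    have left : 2 ≤ L.leaves ∨ ∃ l, L = leaf l := by
      cases L with
      | leaf l => exact .inr ⟨l, rfl⟩
      | node b A B =>
        have := A.one_le_leaves; have := B.one_le_leaves
        exact .inl (by simp only [BTree.leaves]; omega)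
    have right : 2 ≤ R.leaves ∨ ∃ l, R = leaf l := by
      cases R with
      | leaf l => exact .inr ⟨l, rfl⟩
      | node b A B =>
        have := A.one_le_leaves; have := B.one_le_leaves
        exact .inl (by simp only [BTree.leaves]; omega)
    constructor
    · rcases left with h2L | ⟨l, rfl⟩
      · rcases right with h2R | ⟨l, rfl⟩
        · obtain ⟨os, L', R', hc, hm, hp, hn⟩ := both h2L h2R
          refine ⟨os, _, hc, rfl, fun o ho x hx => ?_, hp, by simp only [BTree.leaves]; omega⟩
          have := hm o ho x hx
          refine ⟨by simp [verts, this], ?_⟩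
          rintro rfl
          tauto
        · obtain ⟨os, S, hc, hm, hp, hn⟩ := (ihL hL).2 h2L a
          refine ⟨os, _, (hc _).1, rfl, fun o ho x hx => ?_, hp,
            by simp only [BTree.leaves]; omega⟩
          have := hm o ho x hx
          refine ⟨by simp [verts, this], ?_⟩
          rintro rfl
          exact haL this
      · rcases right with h2R | ⟨l', rfl⟩
        · obtain ⟨os, S, hc, hm, hp, hn⟩ := (ihR hR).2 h2R a
          refine ⟨os, _, (hc _).2, rfl, fun o ho x hx => ?_, hp,
            by simp only [BTree.leaves]; omega⟩
          have := hm o ho x hx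
          refine ⟨by simp [verts, this], ?_⟩
          rintro rfl
          exact haR this
        · exact ⟨[], _, .nil _, rfl, by simp, by simp, by simp [BTree.leaves]⟩
    · intro _ q
      by_cases h2 : 2 ≤ L.leaves ∧ 2 ≤ R.leaves
      · obtain ⟨os, L', R', hc, hm, hp, hn⟩ := both h2.1 h2.2
        refine ⟨os, _, fun S => ⟨hc.inLeft q S, hc.inRight q S⟩, fun o ho x hx => ?_, hp, hn⟩
        simp [verts, hm o ho x hx]
      · have : (∃ l, L = leaf l) ∨ ∃ l, R = leaf l := by tauto
        rcases this with ⟨l, rfl⟩ | ⟨l, rfl⟩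
        -- One child is a leaf. The first claim, which spares the root of the other subtree, leaves
        -- room for one more shunt, of this leaf. The count is `1 + (3 * os.length + 2) = 3 *
        -- (os.length + 1)`.
        · obtain ⟨os, S', hc, hr, hm, hp, hn⟩ := (ihR hR).1
          have hl : l ∉ R.verts := hdis l (by simp [verts])
          obtain ⟨hm', hp'⟩ := pairwise_disjoint_concat q haR hl hr hm hp
          refine ⟨_, S', fun S => ⟨((hc.inRight a _).inLeft q S).append (.cons ?_ (.nil _)),
            ((hc.inRight a _).inRight q S).append (.cons ?_ (.nil _))⟩, fun o ho x hx => ?_, hp',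
            by simp only [BTree.leaves, List.length_append, List.length_singleton]; omega⟩
          · exact .leftLeft _ _ _ _ _
          · exact .rightLeft _ _ _ _ _
          · have := hm' o ho x hx
            rcases this with h | h | h <;> simp [verts, h]
        · obtain ⟨os, S', hc, hr, hm, hp, hn⟩ := (ihL hL).1
          have hl : l ∉ L.verts := fun h => hdis l h (by simp [verts])
          obtain ⟨hm', hp'⟩ := pairwise_disjoint_concat q haL hl hr hm hp
          refine ⟨_, S', fun S => ⟨((hc.inLeft a _).inLeft q S).append (.cons ?_ (.nil _)),
            ((hc.inLeft a _).inRight q S).append (.cons ?_ (.nil _))⟩, fun o ho x hx => ?_, hp',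
            by simp only [BTree.leaves, List.length_append, List.length_singleton]; omega⟩
          · exact .leftRight _ _ _ _ _
          · exact .rightRight _ _ _ _ _
          · have := hm' o ho x hx
            rcases this with h | h | h <;> simp [verts, h]

theorem exists_disjoint_shunts {T : BTree V} (hT : T.verts.Nodup) {k : ℕ}
    (hk : 3 * k ≤ T.leaves) : ∃ os T', os.length = k ∧ ContractAll T os T' ∧
      os.Pairwise (fun a b => Disjoint a.operands b.operands) := by
  obtain ⟨os, T', hc, -, -, hp, hn⟩ := (exists_disjoint_shunts_aux T hT).1
  obtain ⟨T'', hc'⟩ := hc.take k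
  exact ⟨os.take k, T'', by rw [List.length_take]; omega, hc', hp.sublist (List.take_sublist _ _)⟩

/-! ### Scheduling the contraction on `c` processors. -/

theorem ContractAll.nodup {T T' : BTree V} {os : List (ShuntOp V)} (h : ContractAll T os T')
    (hT : T.verts.Nodup) : T'.verts.Nodup := by
  induction h with
  | nil => exact hT
  | cons h1 _ ih => exact ih (h1.nodup hT).2.2.2

/-- The parallel shunt steps, each with at most `c` disjoint operations, that contract a tree to
depth at most one. -/
inductive Schedule (c : ℕ) : BTree V → List (List (ShuntOp V)) → Prop
  | nil {T : BTree V} : T.depth ≤ 1 → Schedule c T []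
  | cons {T T' : BTree V} {os : List (ShuntOp V)} {oss : List (List (ShuntOp V))} :
      os.length ≤ c → os.Pairwise (fun a b => Disjoint a.operands b.operands) →
      ContractAll T os T' → Schedule c T' oss → Schedule c T (os :: oss)

theorem exists_schedule_cons {c k b : ℕ} {T : BTree V} (hT : T.verts.Nodup)
    (hk : 3 * k ≤ T.leaves) (hkc : k ≤ c)
    (h : ∀ T' : BTree V, T'.verts.Nodup → T.leaves = T'.leaves + k →
      ∃ oss, Schedule c T' oss ∧ oss.length ≤ b) :
    ∃ oss, Schedule c T oss ∧ oss.length ≤ b + 1 := by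
  obtain ⟨os, T', hlen, hc, hp⟩ := exists_disjoint_shunts hT hk
  obtain ⟨oss, hS, hl⟩ := h T' (hc.nodup hT) (hlen ▸ hc.leaves)
  exact ⟨os :: oss, .cons (hlen ▸ hkc) hp hc hS, by simpa using hl⟩

/-- If the number of leaves is small compared to the number of processors, two parallel steps
halve the number of leaves. -/
theorem exists_schedule_of_few_leaves {c : ℕ} (hc : 1 ≤ c) (j : ℕ) (T : BTree V)
    (hT : T.verts.Nodup) (hj : T.leaves < 2 ^ (j + 1) + 2) (hTc : T.leaves ≤ 3 * c + 2) :
    ∃ oss, Schedule c T oss ∧ oss.length ≤ 2 * j + 1 := by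
  induction j generalizing T with
  | zero =>
    rcases Nat.lt_or_ge 2 T.leaves with h | h
    · refine exists_schedule_cons (k := 1) (b := 0) hT (by omega) hc fun T' hT' hl => ?_
      exact ⟨[], .nil (T'.depth_le_one_of_leaves (by omega)), le_rfl⟩
    · exact ⟨[], .nil (T.depth_le_one_of_leaves h), by simp⟩
  | succ j ih =>
    rcases Nat.lt_or_ge 2 T.leaves with h | h
    -- Each step removes a third of the leaves, rounded down; at most `3 * c + 2` leaves means at
    -- most `c` shunts. Two steps leave about `4/9` of the leaves, and even with rounding the excess
    -- over two leaves is at least halved, which is why the bound has the form `2 ^ (j + 1) + 2`.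
    · refine exists_schedule_cons (b := 2 * j + 2) (k := T.leaves / 3) hT (by omega) (by omega)
        fun T' hT' hl => exists_schedule_cons (b := 2 * j + 1) (k := T'.leaves / 3) hT' (by omega)
        (by omega) fun T'' hT'' hl' => ih T'' hT'' ?_ (by omega)
      rw [pow_succ] at hj
      omega
    · exact ⟨[], .nil (T.depth_le_one_of_leaves h), by simp⟩

/-- With more than `2 * c` leaves, `min c (T.leaves / 3)` is at least `c / 2`, so each step lowers
twice the number of leaves by `c` or more. After at most `i` such steps at most `2 * c ≤ 2 ^ (k +
1)` leaves remain. -/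
theorem exists_schedule_of_leaves {c k : ℕ} (hc : 1 ≤ c) (hk : c ≤ 2 ^ k) (i : ℕ) (T : BTree V)
    (hT : T.verts.Nodup) (hi : 2 * T.leaves ≤ 4 * c + i * c) :
    ∃ oss, Schedule c T oss ∧ oss.length ≤ 2 * k + 1 + i := by
  induction i generalizing T with
  | zero => exact exists_schedule_of_few_leaves hc k T hT (by rw [pow_succ]; omega) (by omega)
  | succ i ih =>
    by_cases hle : T.leaves ≤ 2 * c
    · obtain ⟨oss, h, hl⟩ := exists_schedule_of_few_leaves hc k T hT
        (by rw [pow_succ]; omega) (by omega)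
      exact ⟨oss, h, by omega⟩
    · refine exists_schedule_cons (k := min c (T.leaves / 3)) (b := 2 * k + 1 + i) hT (by omega)
        (by omega) fun T' hT' hl => ih T' hT' ?_
      rw [add_mul] at hi
      omega

/-- The number of parallel shunt steps. -/
theorem exists_schedule {c k m : ℕ} (hc : 1 ≤ c) (hk : c ≤ 2 ^ k) {T : BTree V}
    (hT : T.verts.Nodup) (hm : T.size ≤ 4 * c * m) :
    ∃ oss, Schedule c T oss ∧ 2 * oss.length + 1 ≤ 4 * (k + 2 * m) := by
  have hs := T.size_add_one
  have := T.one_le_leaves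
  obtain _ | m := m
  · omega
  -- Here `m` is the old value minus one, the old value zero being impossible for a nonempty tree.
  -- The bound `2 * T.leaves ≤ 4 * c * (m + 1) + 1` loses its `+ 1` by parity, which leaves `4 * c +
  -- (4 * m) * c`.
  obtain ⟨oss, h, hl⟩ := exists_schedule_of_leaves hc hk (4 * m) T hT (by
    have : 4 * c * (m + 1) = 2 * (2 * (c * m) + 2 * c) := by ring
    have : 4 * m * c = 4 * (c * m) := by ring
    omega)
  exact ⟨oss, h, by omega⟩

end DBMax
namespace DBMax

/-! ### Restrictions of assignments -/

section Restrict

variable {Var U : Type*}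

theorem restrict_of_mem {X : Finset Var} {x : Var} (h : x ∈ X) (θ : Asg Var U) :
    restrict X θ x = θ x := if_pos h

theorem restrict_of_notMem {X : Finset Var} {x : Var} (h : x ∉ X) (θ : Asg Var U) :
    restrict X θ x = none := if_neg h

theorem restrict_congr {X : Finset Var} {θ η : Asg Var U} (h : ∀ x ∈ X, θ x = η x) :
    restrict X θ = restrict X η := by
  funext x
  by_cases hx : x ∈ X
  · rw [restrict_of_mem hx, restrict_of_mem hx, h x hx]
  · rw [restrict_of_notMem hx, restrict_of_notMem hx]

theorem restrict_eq_iff {X : Finset Var} {θ η : Asg Var U} :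
    restrict X θ = restrict X η ↔ ∀ x ∈ X, θ x = η x :=
  ⟨fun h x hx => by rw [← restrict_of_mem hx θ, h, restrict_of_mem hx], restrict_congr⟩

theorem restrict_restrict {X Y : Finset Var} (h : X ⊆ Y) (θ : Asg Var U) :
    restrict X (restrict Y θ) = restrict X θ :=
  restrict_congr fun _ hx => restrict_of_mem (h hx) θ

theorem IsOver.restrict_eq {X : Finset Var} {θ : Asg Var U} (h : IsOver X θ) :
    restrict X θ = θ := by
  funext x
  by_cases hx : x ∈ X
  · exact restrict_of_mem hx θ
  · rw [restrict_of_notMem hx]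
    exact (by simpa using (h x).not.2 hx : θ x = none).symm

theorem IsOver.restrict {X Y : Finset Var} {θ : Asg Var U} (h : IsOver X θ) (hY : Y ⊆ X) :
    IsOver Y (restrict Y θ) := by
  intro x
  by_cases hx : x ∈ Y
  · simp [restrict_of_mem hx, hx, (h x).2 (hY hx)]
  · simp [restrict_of_notMem hx, hx]

end Restrict

/-- A sum involving a weight is a weight, never the adjoined neutral element. Hence `Homog` passes
to joins. -/
theorem withZero_add_eq_zero_iff {D : Type*} [AddCommSemigroup D] {a b : WithZero D} :
    a + b = 0 ↔ a = 0 ∧ b = 0 := by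
  induction a <;> induction b <;> simp [← WithZero.coe_add]

/-! ### Relations with values -/

namespace VRel

variable {Var U D : Type*}

/-- All tuples are assignments of the scope. -/
def WF (R : VRel Var U D) : Prop := ∀ t ∈ R.tuples, IsOver R.scope t

/-- The restriction of the assignment to the scope is a tuple of the relation. -/
def Holds (R : VRel Var U D) (η : Asg Var U) : Prop := restrict R.scope η ∈ R.tuples

/-- The value of the restriction of an assignment to the scope. -/
noncomputable def weight (R : VRel Var U D) (η : Asg Var U) : WithZero D :=
  R.val (restrict R.scope η)

/-- Either all tuples have the neutral value, or all tuples have weights as values. -/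
def Homog (R : VRel Var U D) : Prop :=
  (∀ t ∈ R.tuples, R.val t = 0) ∨ ∀ t ∈ R.tuples, R.val t ≠ 0

theorem Homog.zero_iff {R : VRel Var U D} (h : R.Homog) {t t' : Asg Var U} (ht : t ∈ R.tuples)
    (ht' : t' ∈ R.tuples) : R.val t = 0 ↔ R.val t' = 0 := by
  rcases h with h | h <;> simp [h t ht, h t' ht']

theorem WF.holds {R : VRel Var U D} (hR : R.WF) {t : Asg Var U} (ht : t ∈ R.tuples) :
    R.Holds t := by
  rwa [Holds, (hR t ht).restrict_eq]

theorem WF.weight_eq {R : VRel Var U D} (hR : R.WF) {t : Asg Var U} (ht : t ∈ R.tuples) :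
    R.weight t = R.val t := by
  rw [weight, (hR t ht).restrict_eq]

theorem Holds.congr {R : VRel Var U D} {η θ : Asg Var U} (h : R.Holds η)
    (he : ∀ x ∈ R.scope, η x = θ x) : R.Holds θ := by
  rwa [Holds, ← restrict_congr he]

theorem weight_congr {R : VRel Var U D} {η θ : Asg Var U} (he : ∀ x ∈ R.scope, η x = θ x) :
    R.weight η = R.weight θ := by
  rw [weight, restrict_congr he, weight]

theorem wf_unit : (unit Var U D).WF := by
  intro t ht x
  simp only [unit, Finset.mem_singleton] at ht ⊢
  simp [ht]

theorem holds_unit (η : Asg Var U) : (unit Var U D).Holds η := by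
  simp only [Holds, unit, Finset.mem_singleton]
  funext x
  exact restrict_of_notMem (by simp) η

theorem weight_unit (η : Asg Var U) : (unit Var U D).weight η = 0 := rfl

section Join

variable {R S : VRel Var U D}

theorem mem_compatible {a b : Asg Var U} : (a, b) ∈ R.compatible S ↔
    a ∈ R.tuples ∧ b ∈ S.tuples ∧ ∀ x ∈ R.scope, x ∈ S.scope → a x = b x := by
  simp [compatible, and_assoc]

theorem union_apply_of_compatible (hR : R.WF) (hS : S.WF) {a b : Asg Var U}
    (h : (a, b) ∈ R.compatible S) : (∀ x ∈ R.scope, union a b x = a x) ∧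
      (∀ x ∈ S.scope, union a b x = b x) ∧
      ∀ x, x ∉ R.scope ∪ S.scope → union a b x = none := by
  obtain ⟨ha, hb, hab⟩ := mem_compatible.1 h
  have key : ∀ x ∈ R.scope, union a b x = a x := by
    intro x hx
    obtain ⟨u, hu⟩ := Option.isSome_iff_exists.1 ((hR a ha x).2 hx)
    simp [union, hu]
  have hnone : ∀ x, x ∉ R.scope → a x = none := fun x hx => by
    simpa using (hR a ha x).not.2 hx
  refine ⟨key, fun x hx => ?_, fun x hx => ?_⟩
  · by_cases hx' : x ∈ R.scope
    · rw [key x hx', hab x hx' hx]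
    · simp [union, hnone x hx']
  · rw [Finset.mem_union, not_or] at hx
    have : b x = none := by simpa using (hS b hb x).not.2 hx.2
    simp [union, hnone x hx.1, this]

/-- The only pair of tuples that is joined to the restriction of `η`. -/
theorem union_eq_restrict_iff (hR : R.WF) (hS : S.WF) {a b η : Asg Var U} :
    ((a, b) ∈ R.compatible S ∧ union a b = restrict (R.scope ∪ S.scope) η) ↔
      R.Holds η ∧ S.Holds η ∧ a = restrict R.scope η ∧ b = restrict S.scope η := by
  constructor
  · rintro ⟨h, he⟩
    obtain ⟨h1, h2, -⟩ := union_apply_of_compatible hR hS h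
    obtain ⟨ha, hb, -⟩ := mem_compatible.1 h
    have hae : a = restrict R.scope η := by
      rw [← (hR a ha).restrict_eq]
      refine restrict_congr fun x hx => ?_
      rw [← h1 x hx, he, restrict_of_mem (Finset.mem_union_left _ hx)]
    have hbe : b = restrict S.scope η := by
      rw [← (hS b hb).restrict_eq]
      refine restrict_congr fun x hx => ?_
      rw [← h2 x hx, he, restrict_of_mem (Finset.mem_union_right _ hx)]
    subst hae hbe
    exact ⟨ha, hb, rfl, rfl⟩
  · rintro ⟨ha, hb, rfl, rfl⟩
    have hc : (restrict R.scope η, restrict S.scope η) ∈ R.compatible S :=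
      mem_compatible.2 ⟨ha, hb, fun x hx hx' => by
        rw [restrict_of_mem hx, restrict_of_mem hx']⟩
    obtain ⟨h1, h2, h3⟩ := union_apply_of_compatible hR hS hc
    refine ⟨hc, funext fun x => ?_⟩
    by_cases hx : x ∈ R.scope
    · rw [h1 x hx, restrict_of_mem hx, restrict_of_mem (Finset.mem_union_left _ hx)]
    by_cases hx' : x ∈ S.scope
    · rw [h2 x hx', restrict_of_mem hx', restrict_of_mem (Finset.mem_union_right _ hx')]
    · have : x ∉ R.scope ∪ S.scope := by simp [hx, hx']
      rw [h3 x this, restrict_of_notMem this]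

variable [AddCommSemigroup D] [LinearOrder D]

theorem WF.join (hR : R.WF) (hS : S.WF) : (R.join S).WF := by
  intro t ht
  obtain ⟨⟨a, b⟩, hab, rfl⟩ := Finset.mem_image.1 ht
  obtain ⟨h1, h2, h3⟩ := union_apply_of_compatible hR hS hab
  obtain ⟨ha, hb, -⟩ := mem_compatible.1 hab
  intro x
  change (union a b x).isSome ↔ x ∈ R.scope ∪ S.scope
  by_cases hx : x ∈ R.scope
  · simp [h1 x hx, hx, hR a ha x]
  by_cases hx' : x ∈ S.scope
  · simp [h2 x hx', hx', hS b hb x]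
  · have : x ∉ R.scope ∪ S.scope := by simp [hx, hx']
    simp [h3 x this, hx, hx']

theorem holds_join (hR : R.WF) (hS : S.WF) {η : Asg Var U} :
    (R.join S).Holds η ↔ R.Holds η ∧ S.Holds η := by
  constructor
  · intro h
    obtain ⟨⟨a, b⟩, hab⟩ := Finset.mem_image.1 h
    have := (union_eq_restrict_iff hR hS).1 hab
    exact ⟨this.1, this.2.1⟩
  · intro h
    obtain ⟨h1, h2⟩ := (union_eq_restrict_iff hR hS).2 ⟨h.1, h.2, rfl, rfl⟩
    exact Finset.mem_image.2 ⟨_, h1, h2⟩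

/-- Each joined tuple arises from exactly one pair, so the supremum in `VRel.join` is over a
singleton. -/
theorem weight_join (hR : R.WF) (hS : S.WF) {η : Asg Var U} (h : R.Holds η) (h' : S.Holds η) :
    (R.join S).weight η = R.weight η + S.weight η := by
  have : ((R.compatible S).filter fun ab => union ab.1 ab.2 = restrict (R.scope ∪ S.scope) η) =
      {(restrict R.scope η, restrict S.scope η)} := by
    ext ⟨a, b⟩
    rw [Finset.mem_filter, union_eq_restrict_iff hR hS, Finset.mem_singleton, Prod.mk.injEq]
    exact ⟨fun h => h.2.2, fun e => ⟨h, h', e⟩⟩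
  change Finset.sup _ _ = _
  rw [show (R.join S).scope = R.scope ∪ S.scope from rfl, this, Finset.sup_singleton]
  rfl

theorem Homog.join (hR : R.WF) (hS : S.WF) (h : R.Homog) (h' : S.Homog) :
    (R.join S).Homog := by
  have key : ∀ t ∈ (R.join S).tuples, R.Holds t ∧ S.Holds t ∧
      ((R.join S).val t = 0 ↔ R.weight t = 0 ∧ S.weight t = 0) := by
    intro t ht
    obtain ⟨h1, h2⟩ := (holds_join hR hS).1 ((hR.join hS).holds ht)
    refine ⟨h1, h2, ?_⟩
    rw [← (hR.join hS).weight_eq ht, weight_join hR hS h1 h2, withZero_add_eq_zero_iff]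
  rcases h with h | h
  · rcases h' with h' | h'
    · exact .inl fun t ht => let ⟨h1, h2, h3⟩ := key t ht; h3.2 ⟨h _ h1, h' _ h2⟩
    · exact .inr fun t ht h0 => let ⟨h1, h2, h3⟩ := key t ht; h' _ h2 (h3.1 h0).2
  · exact .inr fun t ht h0 => let ⟨h1, h2, h3⟩ := key t ht; h _ h1 (h3.1 h0).1

end Join

section Proj

variable [LinearOrder D] {R : VRel Var U D} {X : Finset Var}

theorem WF.proj (hR : R.WF) (hX : X ⊆ R.scope) : (R.proj X).WF := by
  intro t ht
  obtain ⟨t, h, rfl⟩ := Finset.mem_image.1 ht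
  exact (hR t h).restrict hX

theorem Holds.proj (hX : X ⊆ R.scope) {η : Asg Var U} (h : R.Holds η) : (R.proj X).Holds η :=
  Finset.mem_image.2 ⟨_, h, restrict_restrict hX η⟩

theorem val_le_weight_proj {t η : Asg Var U} (ht : t ∈ R.tuples)
    (h : ∀ x ∈ X, t x = η x) : R.val t ≤ (R.proj X).weight η :=
  Finset.le_sup (f := R.val) (Finset.mem_filter.2 ⟨ht, restrict_congr h⟩)

theorem exists_of_mem_proj {t : Asg Var U} (h : t ∈ (R.proj X).tuples) :
    ∃ t₀ ∈ R.tuples, restrict X t₀ = t ∧ (R.proj X).val t = R.val t₀ := by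
  obtain ⟨t₁, h1, h1'⟩ := Finset.mem_image.1 h
  obtain ⟨t₀, h0, h0'⟩ := Finset.exists_mem_eq_sup
    (R.tuples.filter fun s => restrict X s = t) ⟨t₁, Finset.mem_filter.2 ⟨h1, h1'⟩⟩ R.val
  exact ⟨t₀, (Finset.mem_filter.1 h0).1, (Finset.mem_filter.1 h0).2, h0'⟩

theorem exists_of_holds_proj {η : Asg Var U} (h : (R.proj X).Holds η) :
    ∃ t ∈ R.tuples, (∀ x ∈ X, t x = η x) ∧ (R.proj X).weight η = R.val t := by
  obtain ⟨t, ht, he, hv⟩ := exists_of_mem_proj h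
  exact ⟨t, ht, restrict_eq_iff.1 he, hv⟩

theorem Homog.proj (h : R.Homog) : (R.proj X).Homog := by
  refine h.imp (fun h t ht => ?_) (fun h t ht => ?_) <;>
  · obtain ⟨t₀, h0, -, hv⟩ := exists_of_mem_proj ht
    rw [hv]
    exact h t₀ h0

end Proj

theorem best_eq_none_iff [LinearOrder D] {R : VRel Var U D} : R.best = none ↔ R.tuples = ∅ := by
  unfold best
  split_ifs with h
  · simp [h.ne_empty]
  · simp [Finset.not_nonempty_iff_eq_empty.1 h]

theorem best_spec [LinearOrder D] {R : VRel Var U D} {t : Asg Var U} (h : R.best = some t) :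
    t ∈ R.tuples ∧ ∀ t' ∈ R.tuples, R.val t' ≤ R.val t := by
  unfold best at h
  split_ifs at h with hR
  rw [← Option.some.inj h]
  exact (R.tuples.exists_max_image R.val hR).choose_spec

theorem keep_tuples_none (R : VRel Var U D) : (R.keep none).tuples = ∅ := by
  simp [keep]

theorem keep_tuples_some {R : VRel Var U D} {η θ : Asg Var U} (h : R.Holds θ)
    (he : ∀ x ∈ R.scope, η x = θ x) :
    (R.keep (some η)).tuples = {restrict R.scope θ} := by
  ext t
  simp only [keep, Option.map_some, Option.some.injEq, Finset.mem_filter, Finset.mem_singleton,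
    restrict_congr he]
  exact ⟨fun h => h.2.symm, fun e => ⟨e ▸ h, e.symm⟩⟩

theorem card_keep_le (R : VRel Var U D) (η : Option (Asg Var U)) :
    (R.keep η).tuples.card ≤ R.tuples.card :=
  Finset.card_filter_le _ _

end VRel

/-- The monotonicity of `⊕` on `WithZero D`, for values that are both neutral or both weights. -/
theorem add_le_add_of_zero_iff {D : Type*} [AddCommSemigroup D] [LinearOrder D]
    (hD : ∀ a b b' : D, a + max b b' = max (a + b) (a + b')) {a b : WithZero D} (c : WithZero D)
    (h : a ≤ b) (h0 : a = 0 ↔ b = 0) : c + a ≤ c + b := by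
  induction a with
  | zero => rw [h0.1 rfl]
  | coe a =>
    induction b with
    | zero => simp at h0
    | coe b =>
      induction c with
      | zero => simpa using h
      | coe c =>
        have hab : a ≤ b := by simpa using h
        -- Distributivity over `max` is monotonicity: `c + b = max (c + a) (c + b)`.
        rw [← WithZero.coe_add, ← WithZero.coe_add, WithZero.coe_le_coe, ← max_eq_right hab, hD]
        exact le_max_left _ _

end DBMax
namespace DBMax

/-! ### Solutions of a tree of relations -/

section Machine

open BTree

variable {Var U D V : Type*}

theorem Mem.write_same (M : Mem Var U D V) (a : Addr V) (R : VRel Var U D) :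
    Mem.write M a R a = some R := Function.update_self ..

theorem Mem.write_of_ne (M : Mem Var U D V) {a b : Addr V} (R : VRel Var U D) (h : b ≠ a) :
    Mem.write M a R b = M b := Function.update_of_ne h ..

theorem Mem.read_eq {M : Mem Var U D V} {a : Addr V} {R : VRel Var U D} (h : M a = some R) :
    Mem.read M a = R := by
  simp [Mem.read, h]

theorem Mem.read_congr {M N : Mem Var U D V} {a b : Addr V} (h : M a = N b) :
    Mem.read M a = Mem.read N b := by
  simp [Mem.read, h]

/-- The relation at a vertex. -/
noncomputable def Mem.at (M : Mem Var U D V) (v : V) : VRel Var U D := Mem.read M (.main v)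

/-- The assignments whose restriction to the scope of each vertex is in its relation. -/
def Sol (T : BTree V) (M : Mem Var U D V) : Set (Asg Var U) :=
  {η | ∀ v ∈ T.verts, (M.at v).Holds η}

/-- The sum of the values of the restrictions to the vertices. -/
noncomputable def totalWeight [AddCommSemigroup D] (vs : List V) (M : Mem Var U D V)
    (η : Asg Var U) : WithZero D :=
  (vs.map fun v => (M.at v).weight η).sum

theorem totalWeight_perm [AddCommSemigroup D] {vs ws : List V} (h : vs.Perm ws)
    (M : Mem Var U D V) (η : Asg Var U) : totalWeight vs M η = totalWeight ws M η :=
  (h.map _).sum_eq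

theorem totalWeight_congr [AddCommSemigroup D] {vs : List V} {M N : Mem Var U D V}
    {η θ : Asg Var U} (h : ∀ v ∈ vs, (M.at v).weight η = (N.at v).weight θ) :
    totalWeight vs M η = totalWeight vs N θ := by
  unfold totalWeight
  rw [List.map_congr_left h]

/-- The invariant of the contraction phase. The scope of a vertex contains its original scope and
is contained in the union of the original scopes of the vertex and of its parent; the restrictions
of a tuple to these original scopes stem from the original relations. -/
structure Good (ret : V → Finset Var) (rel : V → Finset (Asg Var U)) (B : ℕ) (T : BTree V)
    (M : Mem Var U D V) : Prop where
  nodup : T.verts.Nodup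
  separated : T.Separated ret
  used : ∀ v ∈ T.verts, M (.main v) = some (M.at v)
  wf : ∀ v ∈ T.verts, (M.at v).WF
  homog : ∀ v ∈ T.verts, (M.at v).Homog
  ret_subset : ∀ v ∈ T.verts, ret v ⊆ (M.at v).scope
  ret_mem : ∀ v ∈ T.verts, ∀ t ∈ (M.at v).tuples, restrict (ret v) t ∈ rel v
  scope_subset : ∀ v w, Child T v w → (M.at v).scope ⊆ ret v ∪ ret w
  parent_mem : ∀ v w, Child T v w → ∀ t ∈ (M.at v).tuples,
    ∃ u ∈ rel w, ∀ x ∈ ret w ∩ (M.at v).scope, t x = u x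
  root_scope : (M.at T.root).scope = ret T.root
  size : ∀ a R, M a = some R → R.tuples.card ≤ B

/-- What has to hold when all shunt operations that were applied to `T` and `M` have been reverted:
the registers of other vertices are unchanged, and each vertex of `T` holds the restriction of the
same best solution, or there is none. -/
structure Post (B : ℕ) [AddCommSemigroup D] [LinearOrder D] (T : BTree V)
    (M N : Mem Var U D V) : Prop where
  main_frame : ∀ v ∉ T.verts, N (.main v) = M (.main v)
  aux_frame : ∀ v ∉ T.verts, N (.aux v) = M (.aux v)
  size : ∀ a R, N a = some R → R.tuples.card ≤ B
  result :
    (Sol T M = ∅ ∧ ∀ v ∈ T.verts, ∃ R, N (.main v) = some R ∧ R.tuples = ∅) ∨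
    ∃ η ∈ Sol T M, (∀ ζ ∈ Sol T M, totalWeight T.verts M ζ ≤ totalWeight T.verts M η) ∧
      ∀ v ∈ T.verts, ∃ R, N (.main v) = some R ∧ R.scope = (M.at v).scope ∧
        R.tuples = {restrict (M.at v).scope η}

/-! ### Shunt operations -/

/-- The join that a shunt operation computes. -/
noncomputable def shuntJoin [AddCommSemigroup D] [LinearOrder D] (M : Mem Var U D V)
    (o : ShuntOp V) : VRel Var U D :=
  ((M.at o.l).join (M.at o.p)).join (M.at o.s)

/-- The new scope in a shunt operation. -/
noncomputable def shuntScope (ret : V → Finset Var) (M : Mem Var U D V) (o : ShuntOp V) :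
    Finset Var :=
  ret o.s ∪ (ret o.q ∩ (M.at o.p).scope)

variable {ret : V → Finset Var} {rel : V → Finset (Asg Var U)} {B : ℕ} {T T' : BTree V}
  {M : Mem Var U D V} {o : ShuntOp V}

theorem Contract.distinct (h : Contract T o T') (hT : T.verts.Nodup) :
    o.l ≠ o.p ∧ o.l ≠ o.s ∧ o.p ≠ o.s := by
  obtain ⟨h1, h2, h3, -⟩ := h.nodup hT
  exact ⟨h1, fun e => h2 (e ▸ h.s_mem), fun e => h3 (e ▸ h.s_mem)⟩

theorem Contract.operands_mem (h : Contract T o T') :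
    o.l ∈ T.verts ∧ o.p ∈ T.verts ∧ o.s ∈ T.verts :=
  ⟨h.child.2.1.mem_verts.1, h.child.1.mem_verts.1, h.subset h.s_mem⟩

theorem Contract.ne_of_mem (h : Contract T o T') (hT : T.verts.Nodup) {v : V}
    (hv : v ∈ T'.verts) : v ≠ o.l ∧ v ≠ o.p :=
  ⟨fun e => (h.nodup hT).2.1 (e ▸ hv), fun e => (h.nodup hT).2.2.1 (e ▸ hv)⟩

theorem Contract.perm_erase (h : Contract T o T') :
    T'.verts.Perm (o.s :: T'.verts.erase o.s) ∧
      T.verts.Perm (o.l :: o.p :: o.s :: T'.verts.erase o.s) :=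
  have h1 := List.perm_cons_erase h.s_mem
  ⟨h1, h.perm.trans ((h1.cons _).cons _)⟩

variable [AddCommSemigroup D] [LinearOrder D]

theorem shuntMem_main_s (ret : V → Finset Var) (M : Mem Var U D V) (o : ShuntOp V) :
    shuntMem ret M o (.main o.s) = some ((shuntJoin M o).proj (shuntScope ret M o)) :=
  Mem.write_same ..

theorem shuntMem_main (ret : V → Finset Var) (M : Mem Var U D V) {v : V}
    (h : v ≠ o.s) : shuntMem ret M o (.main v) = M (.main v) := by
  simp only [shuntMem]
  rw [Mem.write_of_ne _ _ (by simpa using h), Mem.write_of_ne _ _ (by simp)]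

theorem shuntMem_aux_l (ret : V → Finset Var) (M : Mem Var U D V) (o : ShuntOp V) :
    shuntMem ret M o (.aux o.l) = some (M.at o.s) := by
  simp only [shuntMem]
  rw [Mem.write_of_ne _ _ (by simp), Mem.write_same]
  rfl

theorem shuntMem_aux (ret : V → Finset Var) (M : Mem Var U D V) {v : V}
    (h : v ≠ o.l) : shuntMem ret M o (.aux v) = M (.aux v) := by
  simp only [shuntMem]
  rw [Mem.write_of_ne _ _ (by simp), Mem.write_of_ne _ _ (by simpa using h)]

theorem at_shuntMem_s (ret : V → Finset Var) (M : Mem Var U D V) (o : ShuntOp V) :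
    (shuntMem ret M o).at o.s = (shuntJoin M o).proj (shuntScope ret M o) :=
  Mem.read_eq (shuntMem_main_s ret M o)

theorem at_shuntMem (ret : V → Finset Var) (M : Mem Var U D V) {v : V} (h : v ≠ o.s) :
    (shuntMem ret M o).at v = M.at v :=
  Mem.read_congr (shuntMem_main ret M h)

namespace Good

variable (hG : Good ret rel B T M) (h : Contract T o T')
include hG h

theorem wf_shuntJoin : ((M.at o.l).join (M.at o.p)).WF ∧ (shuntJoin M o).WF := by
  obtain ⟨hl, hp, hs⟩ := h.operands_mem
  have := (hG.wf _ hl).join (hG.wf _ hp)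
  exact ⟨this, this.join (hG.wf _ hs)⟩

theorem holds_shuntJoin {η : Asg Var U} :
    (shuntJoin M o).Holds η ↔ (M.at o.l).Holds η ∧ (M.at o.p).Holds η ∧ (M.at o.s).Holds η := by
  obtain ⟨hl, hp, hs⟩ := h.operands_mem
  rw [shuntJoin, VRel.holds_join (hG.wf_shuntJoin h).1 (hG.wf _ hs),
    VRel.holds_join (hG.wf _ hl) (hG.wf _ hp), and_assoc]

theorem weight_shuntJoin {η : Asg Var U} (hη : (shuntJoin M o).Holds η) :
    (shuntJoin M o).weight η =
      (M.at o.l).weight η + (M.at o.p).weight η + (M.at o.s).weight η := by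
  obtain ⟨hl, hp, hs⟩ := h.operands_mem
  obtain ⟨h1, h2, h3⟩ := (hG.holds_shuntJoin h).1 hη
  rw [shuntJoin, VRel.weight_join (hG.wf_shuntJoin h).1 (hG.wf _ hs)
    ((VRel.holds_join (hG.wf _ hl) (hG.wf _ hp)).2 ⟨h1, h2⟩) h3,
    VRel.weight_join (hG.wf _ hl) (hG.wf _ hp) h1 h2]

theorem homog_shuntJoin : (shuntJoin M o).Homog := by
  obtain ⟨hl, hp, hs⟩ := h.operands_mem
  exact VRel.Homog.join (hG.wf_shuntJoin h).1 (hG.wf _ hs)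
    (VRel.Homog.join (hG.wf _ hl) (hG.wf _ hp) (hG.homog _ hl) (hG.homog _ hp)) (hG.homog _ hs)

theorem shuntScope_subset : shuntScope ret M o ⊆ (shuntJoin M o).scope := by
  intro x hx
  have : x ∈ ret o.s → x ∈ (M.at o.s).scope := fun hx => hG.ret_subset _ h.operands_mem.2.2 hx
  simp only [shuntScope, shuntJoin, VRel.join, Finset.mem_union, Finset.mem_inter] at hx ⊢
  tauto

theorem totalWeight_shunt (η : Asg Var U) :
    totalWeight T'.verts (shuntMem ret M o) η =
      totalWeight (T'.verts.erase o.s) M η +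
        ((shuntJoin M o).proj (shuntScope ret M o)).weight η := by
  rw [totalWeight_perm h.perm_erase.1, add_comm]
  have : totalWeight (T'.verts.erase o.s) M η =
      totalWeight (T'.verts.erase o.s) (shuntMem ret M o) η :=
    totalWeight_congr fun v hv => by
      rw [at_shuntMem]
      rintro rfl
      exact (h.nodup hG.nodup).2.2.2.not_mem_erase hv
  rw [this]
  simp only [totalWeight, List.map_cons, List.sum_cons, at_shuntMem_s]

theorem totalWeight_eq {η : Asg Var U} (hη : (shuntJoin M o).Holds η) :
    totalWeight T.verts M η =
      totalWeight (T'.verts.erase o.s) M η + (shuntJoin M o).weight η := by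
  rw [totalWeight_perm h.perm_erase.2, hG.weight_shuntJoin h hη]
  simp only [totalWeight, List.map_cons, List.sum_cons]
  abel

/-- The new scope separates the join from the other remaining vertices. The scope bounds of the
invariant trace `x` to original scopes on both sides, and connectedness then forces it through `s`
or through `p` and `q`. -/
theorem mem_shuntScope {v : V} (hv : v ∈ T'.verts) (hvs : v ≠ o.s) {x : Var}
    (hx : x ∈ (M.at v).scope) (hx' : x ∈ (shuntJoin M o).scope) : x ∈ shuntScope ret M o := by
  obtain ⟨hpq, hlp, hsp⟩ := h.child
  obtain ⟨hvl, hvp⟩ := h.ne_of_mem hG.nodup hv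
  -- a vertex of `T'` that has `x` in its original scope
  obtain ⟨z, hz, hxz⟩ : ∃ z ∈ T'.verts, x ∈ ret z := by
    by_cases hr : v = T'.root
    · rw [hr, h.root_eq, hG.root_scope, ← h.root_eq] at hx
      exact ⟨_, T'.root_mem_verts, hx⟩
    · obtain ⟨w, hw, hc⟩ := exists_parent hv hr
      obtain ⟨rfl, -⟩ | ⟨-, hc'⟩ := h.child_cases hG.nodup hc
      · exact absurd rfl hvs
      · rcases Finset.mem_union.1 (hG.scope_subset _ _ hc' hx) with hx | hx
        exacts [⟨v, hv, hx⟩, ⟨w, hw, hx⟩]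
  have key : ∀ y, (y = o.l ∨ y = o.p) → x ∈ ret y → x ∈ shuntScope ret M o := by
    intro y hy hxy
    rcases h.ret_cases hG.separated hy hz hxy hxz with hs | ⟨hp, hq⟩
    · exact Finset.mem_union_left _ hs
    · exact Finset.mem_union_right _ (Finset.mem_inter.2
        ⟨hq, hG.ret_subset _ h.operands_mem.2.1 hp⟩)
  simp only [shuntJoin, VRel.join, Finset.mem_union] at hx'
  rcases hx' with (hx' | hx') | hx'
  · rcases Finset.mem_union.1 (hG.scope_subset _ _ hlp hx') with h1 | h1
    exacts [key _ (.inl rfl) h1, key _ (.inr rfl) h1]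
  · rcases Finset.mem_union.1 (hG.scope_subset _ _ hpq hx') with h1 | h1
    exacts [key _ (.inr rfl) h1, Finset.mem_union_right _ (Finset.mem_inter.2 ⟨h1, hx'⟩)]
  · rcases Finset.mem_union.1 (hG.scope_subset _ _ hsp hx') with h1 | h1
    exacts [Finset.mem_union_left _ h1, key _ (.inr rfl) h1]

theorem sol_shunt {η : Asg Var U} (hη : η ∈ Sol T M) : η ∈ Sol T' (shuntMem ret M o) := by
  intro v hv
  by_cases hvs : v = o.s
  · subst hvs
    rw [at_shuntMem_s]
    obtain ⟨hl, hp, hs⟩ := h.operands_mem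
    exact ((hG.holds_shuntJoin h).2 ⟨hη _ hl, hη _ hp, hη _ hs⟩).proj (hG.shuntScope_subset h)
  · rw [at_shuntMem ret M hvs]
    exact hη v (h.subset hv)

/-- The tuple that `η` induces on the join is one of those over which the projection maximises. -/
theorem totalWeight_le_shunt (hD : ∀ a b b' : D, a + max b b' = max (a + b) (a + b'))
    {η : Asg Var U} (hη : η ∈ Sol T M) :
    totalWeight T.verts M η ≤ totalWeight T'.verts (shuntMem ret M o) η := by
  obtain ⟨hl, hp, hs⟩ := h.operands_mem
  have hJ := (hG.holds_shuntJoin h).2 ⟨hη _ hl, hη _ hp, hη _ hs⟩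
  rw [hG.totalWeight_eq h hJ, hG.totalWeight_shunt h]
  have hX := hG.shuntScope_subset h
  obtain ⟨t, ht, -, hw⟩ := VRel.exists_of_holds_proj (hJ.proj hX)
  refine add_le_add_of_zero_iff hD _
    (VRel.val_le_weight_proj hJ fun x hx => restrict_of_mem (hX hx) η) ?_
  rw [hw]
  exact (hG.homog_shuntJoin h).zero_iff hJ ht

/-- A tuple of the join that agrees with a solution of the contracted tree, and has maximum value
among such tuples, gives a solution of the tree which is at least as good. -/
theorem exists_sol (hD : ∀ a b b' : D, a + max b b' = max (a + b) (a + b'))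
    {η t : Asg Var U} (hη : η ∈ Sol T' (shuntMem ret M o)) (ht : t ∈ (shuntJoin M o).tuples)
    (hte : ∀ x ∈ shuntScope ret M o, t x = η x)
    (hmax : ∀ t' ∈ (shuntJoin M o).tuples, (∀ x ∈ shuntScope ret M o, t' x = η x) →
      (shuntJoin M o).val t' ≤ (shuntJoin M o).val t) :
    ∃ ζ ∈ Sol T M, totalWeight T'.verts (shuntMem ret M o) η ≤ totalWeight T.verts M ζ ∧
      (∀ x ∈ (shuntJoin M o).scope, t x = ζ x) ∧
      ∀ v ∈ T'.verts, v ≠ o.s → ∀ x ∈ (M.at v).scope, η x = ζ x := by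
  -- The tuple `t` is glued with `η`. At the vertices other than `l`, `p`, `s` nothing changes,
  -- because their scopes meet the scope of the join only inside the new scope, where `t` and `η`
  -- agree.
  set ζ : Asg Var U := fun x => if x ∈ (shuntJoin M o).scope then t x else η x with hζ
  have h1 : ∀ x ∈ (shuntJoin M o).scope, t x = ζ x := fun x hx => (if_pos hx).symm
  have h2 : ∀ v ∈ T'.verts, v ≠ o.s → ∀ x ∈ (M.at v).scope, η x = ζ x := by
    intro v hv hvs x hx
    by_cases hx' : x ∈ (shuntJoin M o).scope
    · rw [← h1 x hx', hte x (hG.mem_shuntScope h hv hvs hx hx')]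
    · exact (if_neg hx').symm
  have hJ : (shuntJoin M o).Holds ζ := ((hG.wf_shuntJoin h).2.holds ht).congr h1
  refine ⟨ζ, ?_, ?_, h1, h2⟩
  · obtain ⟨hl, hp, hs⟩ := (hG.holds_shuntJoin h).1 hJ
    intro v hv
    rcases h.mem_verts_iff.1 hv with rfl | rfl | hv
    · exact hl
    · exact hp
    · by_cases hvs : v = o.s
      · exact hvs ▸ hs
      · have := hη v hv
        rw [at_shuntMem ret M hvs] at this
        exact this.congr (h2 v hv hvs)
  · rw [hG.totalWeight_eq h hJ, hG.totalWeight_shunt h]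
    have : totalWeight (T'.verts.erase o.s) M η = totalWeight (T'.verts.erase o.s) M ζ :=
      totalWeight_congr fun v hv => VRel.weight_congr (h2 v (List.mem_of_mem_erase hv) (by
        rintro rfl
        exact (h.nodup hG.nodup).2.2.2.not_mem_erase hv))
    have hs := hη o.s h.s_mem
    rw [at_shuntMem_s] at hs
    -- The projected value is attained at some `t'` in the fibre over `η`, and `t` is at least as
    -- good by `hmax`.
    obtain ⟨t', ht', hte', hw⟩ := VRel.exists_of_holds_proj hs
    have hwt : (shuntJoin M o).weight ζ = (shuntJoin M o).val t := by
      rw [← (hG.wf_shuntJoin h).2.weight_eq ht, VRel.weight_congr h1]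
    rw [this, hw, hwt]
    exact add_le_add_of_zero_iff hD _ (hmax t' ht' hte')
      ((hG.homog_shuntJoin h).zero_iff ht' ht)

/-- The invariant is preserved by shunt operations. -/
theorem shunt {d : ℕ} (hB : B = d ^ 2) (hd : ∀ v ∈ T.verts, (rel v).card ≤ d) :
    Good ret rel B T' (shuntMem ret M o) := by
  obtain ⟨hl, hp, hs⟩ := h.operands_mem
  obtain ⟨hpq, hlp, hsp⟩ := h.child
  have hX := hG.shuntScope_subset h
  have hnd := h.nodup hG.nodup
  have hsub : ret o.s ⊆ shuntScope ret M o := Finset.subset_union_left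
  -- the restrictions of the new tuples
  have hnew : ∀ t ∈ ((shuntJoin M o).proj (shuntScope ret M o)).tuples,
      restrict (ret o.s) t ∈ rel o.s ∧
        ∃ u ∈ rel o.q, ∀ x ∈ ret o.q ∩ (M.at o.p).scope, t x = u x := by
    intro t ht
    obtain ⟨t₀, h0, rfl, -⟩ := VRel.exists_of_mem_proj ht
    obtain ⟨-, h2, h3⟩ := (hG.holds_shuntJoin h).1 ((hG.wf_shuntJoin h).2.holds h0)
    constructor
    · have := hG.ret_mem _ hs _ h3
      rw [restrict_restrict (hG.ret_subset _ hs)] at this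
      rwa [restrict_restrict hsub]
    · obtain ⟨u, hu, he⟩ := hG.parent_mem _ _ hpq _ h2
      refine ⟨u, hu, fun x hx => ?_⟩
      have hx' : x ∈ shuntScope ret M o := Finset.mem_union_right _ hx
      rw [restrict_of_mem hx', ← he x hx,
        restrict_of_mem (Finset.mem_inter.1 hx).2]
  refine ⟨hnd.2.2.2, h.separated hG.separated, fun v hv => ?_, fun v hv => ?_, fun v hv => ?_,
    fun v hv => ?_, fun v hv => ?_, fun v w hvw => ?_, fun v w hvw => ?_, ?_, fun a R hR => ?_⟩
  · by_cases hvs : v = o.s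
    · rw [hvs, at_shuntMem_s, shuntMem_main_s]
    · rw [at_shuntMem _ _ hvs, shuntMem_main _ _ hvs, hG.used v (h.subset hv)]
  · by_cases hvs : v = o.s
    · rw [hvs, at_shuntMem_s]
      exact (hG.wf_shuntJoin h).2.proj hX
    · rw [at_shuntMem _ _ hvs]
      exact hG.wf v (h.subset hv)
  · by_cases hvs : v = o.s
    · rw [hvs, at_shuntMem_s]
      exact (hG.homog_shuntJoin h).proj
    · rw [at_shuntMem _ _ hvs]
      exact hG.homog v (h.subset hv)
  · by_cases hvs : v = o.s
    · rw [hvs, at_shuntMem_s]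
      exact hsub
    · rw [at_shuntMem _ _ hvs]
      exact hG.ret_subset v (h.subset hv)
  · by_cases hvs : v = o.s
    · rw [hvs, at_shuntMem_s]
      exact fun t ht => (hnew t ht).1
    · rw [at_shuntMem _ _ hvs]
      exact hG.ret_mem v (h.subset hv)
  · rcases h.child_cases hG.nodup hvw with ⟨rfl, rfl⟩ | ⟨hvs, hvw⟩
    · rw [at_shuntMem_s]
      exact Finset.union_subset_union_right Finset.inter_subset_left
    · rw [at_shuntMem _ _ hvs]
      exact hG.scope_subset v w hvw
  · rcases h.child_cases hG.nodup hvw with ⟨rfl, rfl⟩ | ⟨hvs, hvw⟩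
    · rw [at_shuntMem_s]
      intro t ht
      obtain ⟨u, hu, he⟩ := (hnew t ht).2
      refine ⟨u, hu, fun x hx => he x ?_⟩
      obtain ⟨hxq, hx⟩ := Finset.mem_inter.1 hx
      -- A variable common to `ret s` and `ret q` is in `ret p` by connectedness, so the tuple `u`
      -- found for `p` covers it as well.
      rcases Finset.mem_union.1 hx with hx | hx
      · exact Finset.mem_inter.2
          ⟨hxq, hG.ret_subset _ hp (h.ret_s_q hG.separated hx hxq)⟩
      · exact hx
    · rw [at_shuntMem _ _ hvs]
      exact hG.parent_mem v w hvw
  -- A shunt rewrites only `s`, which has a parent and so is not the root.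
  · rw [at_shuntMem _ _ (by rw [h.root_eq]; exact (hsp.ne_root hG.nodup).symm), h.root_eq,
      hG.root_scope]
  · have hcard : ((shuntJoin M o).proj (shuntScope ret M o)).tuples.card ≤ B := by
      let Y := ret o.q ∩ (M.at o.p).scope
      -- The new scope is `ret s ∪ Y`, so this map is injective on the new relation. Its first
      -- component lies in an original relation and its second is a restriction of a tuple of one.
      let g : Asg Var U → Asg Var U × Asg Var U := fun t => (restrict (ret o.s) t, restrict Y t)
      calc _ ≤ (rel o.s ×ˢ (rel o.q).image (restrict Y)).card := by
            refine Finset.card_le_card_of_injOn g (fun t ht => ?_) fun t ht t' ht' he => ?_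
            · obtain ⟨h1, u, hu, h2⟩ := hnew t ht
              exact Finset.mem_product.2 ⟨h1, Finset.mem_image.2 ⟨u, hu,
                (restrict_congr h2).symm⟩⟩
            · have hwf := (hG.wf_shuntJoin h).2.proj hX
              obtain ⟨h1, h2⟩ := Prod.mk.inj he
              rw [← (hwf t ht).restrict_eq, ← (hwf t' ht').restrict_eq]
              refine restrict_congr fun x hx => ?_
              rcases Finset.mem_union.1 hx with hx | hx
              exacts [restrict_eq_iff.1 h1 x hx, restrict_eq_iff.1 h2 x hx]
        _ ≤ d * d := by
            rw [Finset.card_product]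
            exact Nat.mul_le_mul (hd _ hs) (Finset.card_image_le.trans (hd _ hpq.mem_verts.2))
        _ = B := by rw [hB, sq]
    cases a with
    | main v =>
      by_cases hvs : v = o.s
      · rw [hvs, shuntMem_main_s] at hR
        exact Option.some.inj hR ▸ hcard
      · rw [shuntMem_main _ _ hvs] at hR
        exact hG.size _ R hR
    | aux v =>
      by_cases hvl : v = o.l
      · rw [hvl, shuntMem_aux_l] at hR
        exact hG.size _ R ((hG.used _ hs).trans hR)
      · rw [shuntMem_aux _ _ hvl] at hR
        exact hG.size _ R hR

end Good

end Machine

end DBMax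
namespace DBMax

section Machine

open BTree

variable {Var U D V : Type*}

theorem foldl_write (N : Mem Var U D V) (f : V → VRel Var U D) (vs : List V) :
    (∀ v, (vs.foldl (fun N v => Mem.write N (.main v) (f v)) N) (.main v) =
        if v ∈ vs then some (f v) else N (.main v)) ∧
      ∀ v, (vs.foldl (fun N v => Mem.write N (.main v) (f v)) N) (.aux v) = N (.aux v) := by
  induction vs generalizing N with
  | nil => simp
  | cons w vs ih =>
    obtain ⟨h1, h2⟩ := ih (Mem.write N (.main w) (f w))
    refine ⟨fun v => ?_, fun v => ?_⟩
    · rw [List.foldl_cons, h1 v]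
      by_cases hv : v ∈ vs
      · simp [hv]
      by_cases hw : v = w
      · simp [hw, Mem.write_same]
      · simp [hv, hw, Mem.write_of_ne]
    · rw [List.foldl_cons, h2 v, Mem.write_of_ne _ _ (by simp)]

/-! ### Reverse shunt operations -/

section Reverse

variable [AddCommSemigroup D] [LinearOrder D]

/-- The assignment that a reverse shunt operation selects. -/
noncomputable def rshuntBest (M : Mem Var U D V) (o : ShuntOp V) : Option (Asg Var U) :=
  (VRel.semijoin (((M.at o.l).join (M.at o.p)).join (Mem.read M (.aux o.l))) (M.at o.s)).best

theorem rshuntMem_eq (M : Mem Var U D V) (o : ShuntOp V) :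
    rshuntMem M o =
      Mem.write (Mem.write (Mem.write M (.main o.l) ((M.at o.l).keep (rshuntBest M o)))
        (.main o.p) ((M.at o.p).keep (rshuntBest M o)))
        (.main o.s) ((Mem.read M (.aux o.l)).keep (rshuntBest M o)) := rfl

theorem rshuntMem_aux (M : Mem Var U D V) (o : ShuntOp V) (v : V) :
    rshuntMem M o (.aux v) = M (.aux v) := by
  rw [rshuntMem_eq, Mem.write_of_ne _ _ (by simp), Mem.write_of_ne _ _ (by simp),
    Mem.write_of_ne _ _ (by simp)]

theorem rshuntMem_main (M : Mem Var U D V) {o : ShuntOp V} {v : V} (hl : v ≠ o.l) (hp : v ≠ o.p)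
    (hs : v ≠ o.s) : rshuntMem M o (.main v) = M (.main v) := by
  rw [rshuntMem_eq, Mem.write_of_ne _ _ (by simpa using hs),
    Mem.write_of_ne _ _ (by simpa using hp), Mem.write_of_ne _ _ (by simpa using hl)]

theorem rshuntMem_main_s (M : Mem Var U D V) (o : ShuntOp V) :
    rshuntMem M o (.main o.s) = some ((Mem.read M (.aux o.l)).keep (rshuntBest M o)) := by
  rw [rshuntMem_eq, Mem.write_same]

theorem rshuntMem_main_p (M : Mem Var U D V) {o : ShuntOp V} (h : o.p ≠ o.s) :
    rshuntMem M o (.main o.p) = some ((M.at o.p).keep (rshuntBest M o)) := by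
  rw [rshuntMem_eq, Mem.write_of_ne _ _ (by simpa using h), Mem.write_same]

theorem rshuntMem_main_l (M : Mem Var U D V) {o : ShuntOp V} (h : o.l ≠ o.p) (h' : o.l ≠ o.s) :
    rshuntMem M o (.main o.l) = some ((M.at o.l).keep (rshuntBest M o)) := by
  rw [rshuntMem_eq, Mem.write_of_ne _ _ (by simpa using h'),
    Mem.write_of_ne _ _ (by simpa using h), Mem.write_same]

theorem mem_operands {o : ShuntOp V} {v : V} :
    v ∈ o.operands ↔ v = o.l ∨ v = o.p ∨ v = o.s := by
  simp [ShuntOp.operands]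

/-- What a reverse shunt operation writes depends only on the registers it reads. -/
theorem rshuntMem_congr {M N : Mem Var U D V} {o : ShuntOp V}
    (hm : ∀ v ∈ o.operands, M (.main v) = N (.main v)) (ha : M (.aux o.l) = N (.aux o.l))
    {v : V} (hv : v ∈ o.operands) : rshuntMem M o (.main v) = rshuntMem N o (.main v) := by
  have hl : M.at o.l = N.at o.l := Mem.read_congr (hm _ (mem_operands.2 (.inl rfl)))
  have hp : M.at o.p = N.at o.p := Mem.read_congr (hm _ (mem_operands.2 (.inr (.inl rfl))))
  have hs : M.at o.s = N.at o.s := Mem.read_congr (hm _ (mem_operands.2 (.inr (.inr rfl))))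
  have ha' := Mem.read_congr ha
  have hb : rshuntBest M o = rshuntBest N o := by rw [rshuntBest, rshuntBest, hl, hp, hs, ha']
  by_cases hvs : v = o.s
  · rw [hvs, rshuntMem_main_s, rshuntMem_main_s, hb, ha']
  by_cases hvp : v = o.p
  · rw [hvp, rshuntMem_main_p _ (hvp ▸ hvs), rshuntMem_main_p _ (hvp ▸ hvs), hb, hp]
  obtain rfl : v = o.l := by simpa [mem_operands, hvs, hvp] using hv
  rw [rshuntMem_main_l _ hvp hvs, rshuntMem_main_l _ hvp hvs, hb, hl]

theorem rshuntMem_of_notMem (M : Mem Var U D V) {o : ShuntOp V} {v : V} (hv : v ∉ o.operands) :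
    rshuntMem M o (.main v) = M (.main v) := by
  simp only [mem_operands, not_or] at hv
  exact rshuntMem_main M hv.1 hv.2.1 hv.2.2

/-- Reverse shunt operations with disjoint operands commute. -/
theorem rshuntMem_comm (M : Mem Var U D V) {a b : ShuntOp V}
    (h : Disjoint a.operands b.operands) :
    rshuntMem (rshuntMem M a) b = rshuntMem (rshuntMem M b) a := by
  have key : ∀ {a b : ShuntOp V}, Disjoint a.operands b.operands → ∀ v ∈ b.operands,
      rshuntMem (rshuntMem M a) b (.main v) = rshuntMem (rshuntMem M b) a (.main v) := by
    intro a b h v hv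
    have hd : ∀ w ∈ b.operands, w ∉ a.operands := fun w hw => Finset.disjoint_right.1 h hw
    rw [rshuntMem_of_notMem _ (hd v hv)]
    exact rshuntMem_congr (fun w hw => rshuntMem_of_notMem _ (hd w hw)) (rshuntMem_aux _ _ _) hv
  funext x
  cases x with
  | aux v => simp only [rshuntMem_aux]
  | main v =>
    by_cases hb : v ∈ b.operands
    · exact key h v hb
    by_cases ha : v ∈ a.operands
    · exact (key h.symm v ha).symm
    · rw [rshuntMem_of_notMem _ hb, rshuntMem_of_notMem _ ha, rshuntMem_of_notMem _ ha,
        rshuntMem_of_notMem _ hb]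

/-- The machine reverts the operations of a step in listed order, whereas undoing them one by one
needs the opposite order. Disjointness of the operands makes the two agree. -/
theorem foldl_rshuntMem (M : Mem Var U D V) {os : List (ShuntOp V)}
    (h : os.Pairwise fun a b => Disjoint a.operands b.operands) :
    os.foldl rshuntMem M = os.foldr (fun o M => rshuntMem M o) M := by
  rw [← List.foldl_reverse]
  refine (List.reverse_perm os).symm.foldl_eq' (fun a ha b hb M => ?_) M
  by_cases hab : a = b
  · rw [hab]
  · have hs : Std.Symm fun a b : ShuntOp V => Disjoint a.operands b.operands :=
      ⟨fun _ _ h => h.symm⟩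
    exact rshuntMem_comm M (h.forall ha hb hab)

variable {ret : V → Finset Var} {rel : V → Finset (Asg Var U)} {B : ℕ} {T T' : BTree V}
  {M N : Mem Var U D V} {o : ShuntOp V}

/-- The induction step of the backward phase. The frame conditions of `Post` ensure that `l`, `p`
and the relation put aside still have the contents the shunt left there, so the join of the shunt is
recovered. -/
theorem Post.rshunt (hD : ∀ a b b' : D, a + max b b' = max (a + b) (a + b'))
    (hG : Good ret rel B T M) (h : Contract T o T') (hP : Post B T' (shuntMem ret M o) N) :
    Post B T M (rshuntMem N o) := by
  obtain ⟨hl, hp, hs⟩ := h.operands_mem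
  obtain ⟨dlp, dls, dps⟩ := h.distinct hG.nodup
  have hnd := h.nodup hG.nodup
  have hNl : N (.main o.l) = M (.main o.l) :=
    (hP.main_frame _ hnd.2.1).trans (shuntMem_main _ _ dls)
  have hNp : N (.main o.p) = M (.main o.p) :=
    (hP.main_frame _ hnd.2.2.1).trans (shuntMem_main _ _ dps)
  have hNa : N (.aux o.l) = some (M.at o.s) :=
    (hP.aux_frame _ hnd.2.1).trans (shuntMem_aux_l _ _ _)
  have hNl' : N.at o.l = M.at o.l := Mem.read_congr hNl
  have hNp' : N.at o.p = M.at o.p := Mem.read_congr hNp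
  have hNa' : Mem.read N (.aux o.l) = M.at o.s := Mem.read_eq hNa
  have hbest : rshuntBest N o = (VRel.semijoin (shuntJoin M o) (N.at o.s)).best := by
    rw [rshuntBest, hNl', hNp', hNa']
    rfl
  have hml := rshuntMem_main_l N dlp dls
  have hmp := rshuntMem_main_p N dps
  have hms := rshuntMem_main_s N o
  rw [hNl'] at hml
  rw [hNp'] at hmp
  rw [hNa'] at hms
  have hX := hG.shuntScope_subset h
  refine ⟨fun v hv => ?_, fun v hv => ?_, fun a R hR => ?_, ?_⟩
  · have hv' : v ∉ T'.verts := fun h' => hv (h.subset h')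
    have hvs : v ≠ o.s := fun e => hv (e ▸ hs)
    have hvl : v ≠ o.l := fun e => hv (e ▸ hl)
    have hvp : v ≠ o.p := fun e => hv (e ▸ hp)
    rw [rshuntMem_main N hvl hvp hvs,
      hP.main_frame v hv', shuntMem_main _ _ hvs]
  · have hvl : v ≠ o.l := fun e => hv (e ▸ hl)
    rw [rshuntMem_aux, hP.aux_frame v fun h' => hv (h.subset h'), shuntMem_aux _ _ hvl]
  · have keep : ∀ v ∈ T.verts, ((M.at v).keep (rshuntBest N o)).tuples.card ≤ B := fun v hv =>
      (VRel.card_keep_le _ _).trans (hG.size _ _ (hG.used v hv))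
    cases a with
    | aux v => exact hP.size _ R (rshuntMem_aux N o v ▸ hR)
    | main v =>
      by_cases hvs : v = o.s
      · rw [hvs, hms] at hR
        exact Option.some.inj hR ▸ keep _ hs
      by_cases hvp : v = o.p
      · rw [hvp, hmp] at hR
        exact Option.some.inj hR ▸ keep _ hp
      by_cases hvl : v = o.l
      · rw [hvl, hml] at hR
        exact Option.some.inj hR ▸ keep _ hl
      · exact hP.size _ R (rshuntMem_main N hvl hvp hvs ▸ hR)
  · rcases hP.result with ⟨hempty, hres⟩ | ⟨η, hη, hmax, hres⟩
    · left
      obtain ⟨R, hR, hRe⟩ := hres o.s h.s_mem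
      have hnone : rshuntBest N o = none := by
        rw [hbest, VRel.best_eq_none_iff, Mem.at, Mem.read_eq hR]
        simp [VRel.semijoin, hRe]
      refine ⟨Set.eq_empty_iff_forall_notMem.2 fun ζ hζ => ?_, fun v hv => ?_⟩
      · exact Set.eq_empty_iff_forall_notMem.1 hempty ζ (hG.sol_shunt h hζ)
      · rw [hnone] at hml hmp hms
        rcases h.mem_verts_iff.1 hv with rfl | rfl | hv
        · exact ⟨_, hml, VRel.keep_tuples_none _⟩
        · exact ⟨_, hmp, VRel.keep_tuples_none _⟩
        · by_cases hvs : v = o.s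
          · exact ⟨_, hvs ▸ hms, VRel.keep_tuples_none _⟩
          · obtain ⟨hvl, hvp⟩ := h.ne_of_mem hG.nodup hv
            rw [rshuntMem_main N hvl hvp hvs]
            exact hres v hv
    · right
      obtain ⟨R, hR, hRs, hRt⟩ := hres o.s h.s_mem
      rw [at_shuntMem_s] at hRs hRt
      replace hRs : R.scope = shuntScope ret M o := hRs
      replace hRt : R.tuples = {restrict (shuntScope ret M o) η} := hRt
      have hNs : N.at o.s = R := Mem.read_eq hR
      have hsemi : ∀ t, t ∈ (VRel.semijoin (shuntJoin M o) (N.at o.s)).tuples ↔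
          t ∈ (shuntJoin M o).tuples ∧ ∀ x ∈ shuntScope ret M o, t x = η x := by
        intro t
        rw [hNs]
        simp only [VRel.semijoin, Finset.mem_filter, hRt, Finset.mem_singleton, exists_eq_left,
          hRs, Finset.inter_eq_right.2 hX]
        exact and_congr_right fun _ => forall₂_congr fun x hx => by rw [restrict_of_mem hx]
      have hsol := hη o.s h.s_mem
      rw [at_shuntMem_s] at hsol
      obtain ⟨t₁, ht₁, hte₁, -⟩ := VRel.exists_of_holds_proj hsol
      obtain ⟨t, ht⟩ : ∃ t, rshuntBest N o = some t := by
        refine Option.ne_none_iff_exists'.1 fun hnone => ?_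
        rw [hbest, VRel.best_eq_none_iff] at hnone
        exact Finset.eq_empty_iff_forall_notMem.1 hnone t₁ ((hsemi t₁).2 ⟨ht₁, hte₁⟩)
      obtain ⟨htm, htmax⟩ := VRel.best_spec (hbest ▸ ht)
      obtain ⟨htJ, hte⟩ := (hsemi t).1 htm
      obtain ⟨ζ, hζ, hw, hζt, hζη⟩ := hG.exists_sol h hD hη htJ hte
        fun t' ht' hte' => htmax t' ((hsemi t').2 ⟨ht', hte'⟩)
      -- Any solution `θ` of `T` has at most its value in the contracted tree, which is at most that
      -- of the best `η` there, which is at most that of `ζ` in `T`.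
      refine ⟨ζ, hζ, fun θ hθ => ((hG.totalWeight_le_shunt h hD hθ).trans
        (hmax θ (hG.sol_shunt h hθ))).trans hw, fun v hv => ?_⟩
      have hsub : ∀ {v x}, (v = o.l ∨ v = o.p ∨ v = o.s) → x ∈ (M.at v).scope →
          x ∈ (shuntJoin M o).scope := by
        rintro v x (rfl | rfl | rfl) hx <;> simp [shuntJoin, VRel.join, hx]
      rw [ht] at hml hmp hms
      rcases h.mem_verts_iff.1 hv with rfl | rfl | hv'
      · exact ⟨_, hml, rfl, VRel.keep_tuples_some (hζ _ hv) fun x hx => hζt x (hsub (.inl rfl) hx)⟩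
      · exact ⟨_, hmp, rfl, VRel.keep_tuples_some (hζ _ hv)
          fun x hx => hζt x (hsub (.inr (.inl rfl)) hx)⟩
      · by_cases hvs : v = o.s
        · subst hvs
          exact ⟨_, hms, rfl, VRel.keep_tuples_some (hζ _ hv)
            fun x hx => hζt x (hsub (.inr (.inr rfl)) hx)⟩
        · obtain ⟨hvl, hvp⟩ := h.ne_of_mem hG.nodup hv'
          obtain ⟨R, hR, hRs, hRt⟩ := hres v hv'
          rw [at_shuntMem _ _ hvs] at hRs hRt
          refine ⟨R, ?_, hRs, ?_⟩
          · rw [rshuntMem_main N hvl hvp hvs, hR]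
          · rw [hRt, restrict_congr (hζη v hv' hvs)]

/-! ### Selection -/

/-- The accumulator `R` is arbitrary to let the induction over the fold go through. -/
theorem joinAll_foldl (M : Mem Var U D V) (vs : List V) (hM : ∀ v ∈ vs, (M.at v).WF)
    (R : VRel Var U D) (hR : R.WF) :
    let S := vs.foldl (fun R v => R.join (Mem.read M (.main v))) R
    S.WF ∧ R.scope ⊆ S.scope ∧ (∀ v ∈ vs, (M.at v).scope ⊆ S.scope) ∧
      ∀ η, (S.Holds η ↔ R.Holds η ∧ ∀ v ∈ vs, (M.at v).Holds η) ∧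
        (S.Holds η → S.weight η = R.weight η + totalWeight vs M η) := by
  induction vs generalizing R with
  | nil => simp [hR, totalWeight]
  | cons v vs ih =>
    have hv := hM v (by simp)
    obtain ⟨h1, h2, h3, h4⟩ := ih (fun w hw => hM w (by simp [hw])) (R.join (M.at v)) (hR.join hv)
    refine ⟨h1, Finset.subset_union_left.trans h2, fun w hw => ?_, fun η => ?_⟩
    · rcases List.mem_cons.1 hw with rfl | hw
      · exact Finset.subset_union_right.trans h2
      · exact h3 w hw
    · obtain ⟨h5, h6⟩ := h4 η
      rw [VRel.holds_join hR hv] at h5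
      refine ⟨h5.trans (by simp [and_assoc]), fun h => (h6 h).trans ?_⟩
      obtain ⟨⟨h7, h8⟩, -⟩ := h5.1 h
      rw [VRel.weight_join hR hv h7 h8]
      simp only [totalWeight, List.map_cons, List.sum_cons, add_assoc]

theorem joinAll_spec {M : Mem Var U D V} {vs : List V} (hM : ∀ v ∈ vs, (M.at v).WF) :
    (joinAll M vs).WF ∧ (∀ v ∈ vs, (M.at v).scope ⊆ (joinAll M vs).scope) ∧
      ∀ η, ((joinAll M vs).Holds η ↔ ∀ v ∈ vs, (M.at v).Holds η) ∧
        ((joinAll M vs).Holds η → (joinAll M vs).weight η = totalWeight vs M η) := by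
  obtain ⟨h1, -, h2, h3⟩ := joinAll_foldl M vs hM _ VRel.wf_unit
  change (joinAll M vs).WF at h1
  change ∀ η, ((joinAll M vs).Holds η ↔ _) ∧ ((joinAll M vs).Holds η →
    (joinAll M vs).weight η = _) at h3
  refine ⟨h1, h2, fun η => ⟨?_, fun h => ?_⟩⟩
  · simpa [VRel.holds_unit] using (h3 η).1
  · simpa [VRel.weight_unit] using (h3 η).2 h

theorem selectMem_main (M : Mem Var U D V) (vs : List V) (v : V) :
    selectMem M vs (.main v) =
      if v ∈ vs then some ((M.at v).keep (joinAll M vs).best) else M (.main v) :=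
  (foldl_write M (fun v => (M.at v).keep (joinAll M vs).best) vs).1 v

theorem selectMem_aux (M : Mem Var U D V) (vs : List V) (v : V) :
    selectMem M vs (.aux v) = M (.aux v) :=
  (foldl_write M (fun v => (M.at v).keep (joinAll M vs).best) vs).2 v

/-- The base case of the backward phase: tuples of the full join are solutions of the tree, and
their values are the total weights. -/
theorem Good.post_select (hG : Good ret rel B T M) : Post B T M (selectMem M T.verts) := by
  obtain ⟨h1, h2, h3⟩ := joinAll_spec hG.wf
  refine ⟨fun v hv => ?_, fun v _ => selectMem_aux M _ v, fun a R hR => ?_, ?_⟩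
  · rw [selectMem_main, if_neg hv]
  · cases a with
    | aux v => exact hG.size _ R (selectMem_aux M _ v ▸ hR)
    | main v =>
      rw [selectMem_main] at hR
      split_ifs at hR with hv
      · exact Option.some.inj hR ▸
          (VRel.card_keep_le _ _).trans (hG.size _ _ (hG.used v hv))
      · exact hG.size _ R hR
  · have hsel : ∀ v ∈ T.verts, selectMem M T.verts (.main v) =
        some ((M.at v).keep (joinAll M T.verts).best) := fun v hv => by
      rw [selectMem_main, if_pos hv]
    rcases hb : (joinAll M T.verts).best with _ | t
    · rw [hb] at hsel
      rw [VRel.best_eq_none_iff] at hb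
      refine .inl ⟨Set.eq_empty_iff_forall_notMem.2 fun η hη => ?_,
        fun v hv => ⟨_, hsel v hv, VRel.keep_tuples_none _⟩⟩
      exact Finset.eq_empty_iff_forall_notMem.1 hb _ ((h3 η).1.2 hη)
    · rw [hb] at hsel
      obtain ⟨ht, hmax⟩ := VRel.best_spec hb
      have htH := h1.holds ht
      have htS : t ∈ Sol T M := (h3 t).1.1 htH
      refine .inr ⟨t, htS, fun ζ hζ => ?_,
        fun v hv => ⟨_, hsel v hv, rfl, VRel.keep_tuples_some (htS v hv) fun _ _ => rfl⟩⟩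
      have hζH := (h3 ζ).1.2 hζ
      rw [← (h3 ζ).2 hζH, ← (h3 t).2 htH, h1.weight_eq ht]
      exact hmax _ hζH

end Reverse

end Machine

end DBMax
namespace DBMax

section Machine

open BTree

variable {Var U D V : Type*}

/-! ### Counting the stored relations -/

/-- The relations in the registers of a memory. -/
def Mem.graph (M : Mem Var U D V) : Set (Addr V × VRel Var U D) := {x | M x.1 = some x.2}

theorem Mem.graph_write (M : Mem Var U D V) (a : Addr V) (R : VRel Var U D) :
    (Mem.write M a R).graph ⊆ M.graph ∪ {(a, R)} := by
  rintro ⟨b, S⟩ h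
  by_cases hb : b = a
  · subst hb
    have : Mem.write M b R b = some S := h
    rw [Mem.write_same] at this
    exact .inr (by rw [Option.some.inj this]; rfl)
  · exact .inl ((Mem.write_of_ne M R hb).symm.trans h)

/-- The memory `N` results from `M` by at most `k` register assignments. -/
def WritesLE (k : ℕ) (M N : Mem Var U D V) : Prop :=
  ∃ S : Set (Addr V × VRel Var U D), S.encard ≤ k ∧ N.graph ⊆ M.graph ∪ S

theorem WritesLE.refl (M : Mem Var U D V) : WritesLE 0 M M := ⟨∅, by simp, by simp⟩

theorem writesLE_write (M : Mem Var U D V) (a : Addr V) (R : VRel Var U D) :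
    WritesLE 1 M (Mem.write M a R) :=
  ⟨{(a, R)}, by simp, M.graph_write a R⟩

theorem WritesLE.trans {k k' : ℕ} {M N P : Mem Var U D V} (h : WritesLE k M N)
    (h' : WritesLE k' N P) : WritesLE (k + k') M P := by
  obtain ⟨S, h1, h2⟩ := h
  obtain ⟨S', h1', h2'⟩ := h'
  refine ⟨S ∪ S', (Set.encard_union_le _ _).trans ?_, h2'.trans ?_⟩
  · push_cast
    exact add_le_add h1 h1'
  · rw [← Set.union_assoc]
    exact Set.union_subset_union_left _ h2

theorem WritesLE.foldl {α : Type*} {k : ℕ} {f : Mem Var U D V → α → Mem Var U D V}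
    (hf : ∀ M a, WritesLE k M (f M a)) (l : List α) (M : Mem Var U D V) :
    WritesLE (k * l.length) M (l.foldl f M) := by
  induction l generalizing M with
  | nil => exact .refl M
  | cons a l ih =>
    have := (hf M a).trans (ih (f M a))
    rwa [add_comm, ← Nat.mul_succ] at this

theorem storedRelations_cons (σ : Config Var U D V) (tr : List (Config Var U D V)) :
    storedRelations (σ :: tr) = σ.mem.graph ∪ storedRelations tr := by
  ext x
  simp [storedRelations, Mem.graph]

theorem storedRelations_nil :
    storedRelations ([] : List (Config Var U D V)) = ∅ := by
  simp [storedRelations]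

theorem storedRelations_append (tr tr' : List (Config Var U D V)) :
    storedRelations (tr ++ tr') = storedRelations tr ∪ storedRelations tr' := by
  ext x
  simp [storedRelations, or_and_right, exists_or]

variable [AddCommSemigroup D] [LinearOrder D]

theorem writesLE_shuntMem (ret : V → Finset Var) (M : Mem Var U D V) (o : ShuntOp V) :
    WritesLE 2 M (shuntMem ret M o) :=
  (writesLE_write _ _ _).trans (writesLE_write _ _ _)

theorem writesLE_rshuntMem (M : Mem Var U D V) (o : ShuntOp V) : WritesLE 3 M (rshuntMem M o) :=
  ((writesLE_write _ _ _).trans (writesLE_write _ _ _)).trans (writesLE_write _ _ _)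

theorem writesLE_selectMem (M : Mem Var U D V) (vs : List V) :
    WritesLE vs.length M (selectMem M vs) := by
  have := WritesLE.foldl (k := 1)
    (f := fun N v => Mem.write N (.main v) ((M.at v).keep (joinAll M vs).best))
    (fun _ _ => writesLE_write _ _ _) vs M
  rwa [one_mul] at this

/-! ### Running the program -/

variable {c : ℕ} {ret : V → Finset Var} {rel : V → Finset (Asg Var U)} {B : ℕ} {T T' : BTree V}
  {M : Mem Var U D V}

theorem Run.concat {σ τ τ' : Config Var U D V} {p : List (Instr V)} {i : Instr V}
    {tr : List (Config Var U D V)} (h : Run c ret σ p tr τ) (hi : Exec c ret τ i τ') :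
    Run c ret σ (p ++ [i]) (tr ++ [τ']) τ' := by
  induction h with
  | nil σ => exact .cons hi (.nil _)
  | cons h1 _ ih => exact .cons h1 (ih hi)

theorem Run.last_mem {σ τ : Config Var U D V} {p : List (Instr V)}
    {tr : List (Config Var U D V)} (h : Run c ret σ p tr τ) :
    τ.mem.graph ⊆ storedRelations tr := by
  induction h with
  | nil σ => rw [storedRelations_cons]; exact Set.subset_union_left
  | cons _ _ ih => rw [storedRelations_cons]; exact ih.trans Set.subset_union_right

/-- Sequences of shunt operations preserve the invariant, and reverting them leads back. -/
theorem Good.shunts (hD : ∀ a b b' : D, a + max b b' = max (a + b) (a + b')) {d : ℕ}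
    (hB : B = d ^ 2) {os : List (ShuntOp V)} (h : ContractAll T os T') (hG : Good ret rel B T M)
    (hd : ∀ v ∈ T.verts, (rel v).card ≤ d) :
    Good ret rel B T' (os.foldl (shuntMem ret) M) ∧
      (∀ v ∈ T'.verts, (rel v).card ≤ d) ∧
      ∀ N, Post B T' (os.foldl (shuntMem ret) M) N →
        Post B T M (os.foldr (fun o N => rshuntMem N o) N) := by
  induction h generalizing M with
  | nil => exact ⟨hG, hd, fun N h => h⟩
  | cons h _ ih =>
    obtain ⟨h1, h2, h3⟩ := ih (hG.shunt h hB hd) fun v hv => hd v (h.subset hv)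
    exact ⟨h1, h2, fun N hN => Post.rshunt hD hG h (h3 N hN)⟩

/-- The program that performs the given shunt steps, selects, and reverts the shunt steps. -/
def program : List (List (ShuntOp V)) → List (Instr V)
  | [] => [.select]
  | os :: oss => .shunt os :: (program oss ++ [.rshunt])

theorem length_program (oss : List (List (ShuntOp V))) :
    (program oss).length = 2 * oss.length + 1 := by
  induction oss with
  | nil => rfl
  | cons os oss ih => simp only [program, List.length_cons, List.length_append, ih]; simp; omega

/-- The induction follows the nesting of `program`: the inner run starts with one more history
entry, which the final `rshunt` pops. An arbitrary history `H` makes this possible. -/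
theorem exists_run (hD : ∀ a b b' : D, a + max b b' = max (a + b) (a + b')) {d : ℕ}
    (hB : B = d ^ 2) {oss : List (List (ShuntOp V))} (h : Schedule c T oss)
    (hG : Good ret rel B T M) (hd : ∀ v ∈ T.verts, (rel v).card ≤ d)
    (H : List (List (ShuntOp V) × BTree V)) :
    ∃ tr N, Run c ret ⟨T, H, M⟩ (program oss) tr ⟨T, H, N⟩ ∧ Post B T M N ∧
      (∃ S : Set (Addr V × VRel Var U D), S.encard ≤ (3 * T.size : ℕ) ∧
        storedRelations tr ⊆ M.graph ∪ S) ∧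
      ∀ x ∈ storedRelations tr, x.2.tuples.card ≤ B := by
  induction h generalizing M H with
  | @nil T hT =>
    have hP := hG.post_select
    obtain ⟨S, hS, hsub⟩ := writesLE_selectMem M T.verts
    refine ⟨_, _, .cons (.select hT) (.nil _), hP, ⟨S, hS.trans ?_, ?_⟩, ?_⟩
    · exact_mod_cast (show T.size ≤ 3 * T.size by omega)
    · rw [storedRelations_cons, storedRelations_cons, storedRelations_nil, Set.union_empty]
      exact Set.union_subset Set.subset_union_left hsub
    · rw [storedRelations_cons, storedRelations_cons, storedRelations_nil, Set.union_empty]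
      rintro x (hx | hx)
      exacts [hG.size _ _ hx, hP.size _ _ hx]
  | @cons T T' os oss hc hp hT _ ih =>
    obtain ⟨hG', hd', hback⟩ := hG.shunts hD hB hT hd
    obtain ⟨tr, N, hrun, hP, ⟨S, hS, hsub⟩, hsize⟩ := ih hG' hd' ((os, T) :: H)
    have hP' := hback N hP
    rw [← foldl_rshuntMem N hp] at hP'
    obtain ⟨S₁, hS₁, hsub₁⟩ := WritesLE.foldl (writesLE_shuntMem ret) os M
    obtain ⟨S₂, hS₂, hsub₂⟩ := WritesLE.foldl writesLE_rshuntMem os N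
    refine ⟨_, _, .cons (.shunt hc hp hT) (hrun.concat .rshunt), hP',
      ⟨S₁ ∪ S ∪ S₂, ?_, ?_⟩, ?_⟩
    -- An operation writes two registers when performed and three when reverted, and removes two
    -- vertices: `5 ≤ 3 * 2`.
    · have hle : 2 * os.length + 3 * T'.size + 3 * os.length ≤ 3 * T.size := by
        have := hT.leaves
        have := T.size_add_one
        have := T'.size_add_one
        omega
      calc _ ≤ S₁.encard + S.encard + S₂.encard :=
            (Set.encard_union_le _ _).trans (add_le_add_left (Set.encard_union_le _ _) _)
        _ ≤ ((2 * os.length : ℕ) : ℕ∞) + (3 * T'.size : ℕ) + (3 * os.length : ℕ) :=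
            add_le_add (add_le_add hS₁ hS) hS₂
        _ ≤ _ := by exact_mod_cast hle
    -- The memory before the reversal belongs to the inner trace, so only the writes of the reversal
    -- itself are new.
    · have hlast := hrun.last_mem
      rw [storedRelations_cons, storedRelations_append, storedRelations_cons,
        storedRelations_nil, Set.union_empty]
      have h1 : storedRelations tr ⊆ M.graph ∪ (S₁ ∪ S ∪ S₂) := by
        refine hsub.trans ?_
        rintro x (hx | hx)
        · rcases hsub₁ hx with hx | hx
          exacts [.inl hx, .inr (.inl (.inl hx))]
        · exact .inr (.inl (.inr hx))
      refine Set.union_subset Set.subset_union_left (Set.union_subset h1 ?_)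
      intro x hx
      rcases hsub₂ hx with hx | hx
      exacts [h1 (hlast hx), .inr (.inr hx)]
    · rw [storedRelations_cons, storedRelations_append, storedRelations_cons,
        storedRelations_nil, Set.union_empty]
      rintro x (hx | hx | hx)
      exacts [hG.size _ _ hx, hsize x hx, hP'.size _ _ hx]

end Machine

/-! ### The initial configuration and the answer -/

section Initial

variable {Var K U D V : Type*}

theorem withZero_sum_eq_zero_iff {ι : Type*} [AddCommSemigroup D] {s : Finset ι} {f : ι → D} :
    ∑ i ∈ s, (f i : WithZero D) = 0 ↔ s = ∅ := by
  induction s using Finset.induction_on with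
  | empty => simp
  | insert a s ha _ => simp [Finset.sum_insert ha, withZero_add_eq_zero_iff]

theorem WeightFn.eval_congr {f : WeightFn Var U D} {η θ : Asg Var U}
    (h : ∀ x ∈ f.vars, η x = θ x) : f.eval η = f.eval θ := by
  rw [WeightFn.eval, restrict_congr h, WeightFn.eval]

variable [AddCommSemigroup D] {Φ : Formula Var K} {J : EJoinTree Φ V}
  {DB : Database Φ U} {F : Valuation Var U D} {home : Fin F.m → V}

theorem initial_main {v : V} (hv : v ∈ J.tree.verts) :
    (initial J DB F home).mem (.main v) = some
      { scope := J.sch v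
        tuples := DB.rel (J.con v)
        val := fun t =>
          ∑ i ∈ Finset.univ.filter (fun i => home i = v), ((F.f i).eval t : WithZero D) } :=
  if_pos hv

theorem initial_at {v : V} (hv : v ∈ J.tree.verts) :
    (initial J DB F home).mem.at v =
      { scope := J.sch v
        tuples := DB.rel (J.con v)
        val := fun t =>
          ∑ i ∈ Finset.univ.filter (fun i => home i = v), ((F.f i).eval t : WithZero D) } :=
  Mem.read_eq (initial_main hv)

theorem initial_graph_encard :
    (initial J DB F home).mem.graph.encard ≤ (J.tree.size : ℕ∞) := by
  have : (initial J DB F home).mem.graph ⊆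
      (fun v => (Addr.main v, (initial J DB F home).mem.at v)) '' (J.tree.verts.toFinset : Set V) := by
    rintro ⟨a, R⟩ h
    cases a with
    | aux v => exact absurd h (by simp [Mem.graph, initial])
    | main v =>
      by_cases hv : v ∈ J.tree.verts
      · exact ⟨v, by simpa using hv, congrArg _ (Mem.read_eq h)⟩
      · exact absurd h (by simp [Mem.graph, initial, hv])
  refine (Set.encard_le_encard this).trans ((Set.encard_image_le _ _).trans ?_)
  rw [Set.encard_coe_eq_coe_finsetCard]
  exact_mod_cast List.toFinset_card_le _

/-- Each weight function is counted at exactly one vertex, its home, where the scope determines its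
value. -/
theorem totalWeight_initial
    (hhome : ∀ i, home i ∈ J.tree.verts ∧ (F.f i).vars ⊆ J.sch (home i)) (η : Asg Var U) :
    totalWeight J.tree.verts (initial J DB F home).mem η = F.eval η := by
  have h1 : totalWeight J.tree.verts (initial J DB F home).mem η =
      (J.tree.verts.map fun v =>
        ∑ i ∈ Finset.univ.filter (fun i => home i = v), ((F.f i).eval η : WithZero D)).sum := by
    refine congrArg List.sum (List.map_congr_left fun v hv => ?_)
    rw [initial_at hv]
    change ∑ i ∈ Finset.univ.filter (fun i => home i = v),
      ((F.f i).eval (restrict (J.sch v) η) : WithZero D) = _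
    refine Finset.sum_congr rfl fun i hi => ?_
    obtain rfl := (Finset.mem_filter.1 hi).2
    rw [WeightFn.eval_congr fun x hx => restrict_of_mem ((hhome i).2 hx) η]
  rw [h1, ← List.sum_toFinset _ J.nodup, Valuation.eval]
  exact Finset.sum_fiberwise_of_maps_to (fun i _ => List.mem_toFinset.2 (hhome i).1)
    fun i => ((F.f i).eval η : WithZero D)

variable [Fintype K]

theorem Database.card_rel_le (DB : Database Φ U) (k : K) : (DB.rel k).card ≤ DB.maxSize :=
  Finset.le_sup (f := fun k => (DB.rel k).card) (Finset.mem_univ k)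

theorem Formula.scope_subset_vars (Φ : Formula Var K) (k : K) : Φ.scope k ⊆ Φ.vars :=
  Finset.subset_biUnion_of_mem Φ.scope (Finset.mem_univ k)

theorem good_initial (hDB : GloballyConsistent Φ DB) :
    Good J.sch (fun v => DB.rel (J.con v)) (DB.maxSize ^ 2) J.tree
      (initial J DB F home).mem where
  nodup := J.nodup
  separated := BTree.separated_of_path J.nodup J.connected
  used v hv := by rw [initial_main hv, initial_at hv]
  wf v hv := by rw [initial_at hv]; exact DB.isOver (J.con v)
  homog v hv := by
    rw [initial_at hv]
    -- Which weight functions are attached to `v` does not depend on the tuple.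
    by_cases h : Finset.univ.filter (fun i => home i = v) = ∅
    · exact .inl fun t _ => withZero_sum_eq_zero_iff.2 h
    · exact .inr fun t _ h0 => h (withZero_sum_eq_zero_iff.1 h0)
  ret_subset v hv := by rw [initial_at hv]
  ret_mem v hv t ht := by
    rw [initial_at hv] at ht
    rwa [EJoinTree.sch, (DB.isOver _ t ht).restrict_eq]
  scope_subset v w h := by
    rw [initial_at h.mem_verts.1]
    exact Finset.subset_union_left
  parent_mem v w h t ht := by
    rw [initial_at h.mem_verts.1] at ht ⊢
    -- Global consistency extends the tuple to a solution, whose restriction to the parent's scope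
    -- is the tuple sought.
    obtain ⟨θ, hθ, rfl⟩ := hDB _ t ht
    refine ⟨_, hθ.2 (J.con w), fun x hx => ?_⟩
    obtain ⟨h1, h2⟩ := Finset.mem_inter.1 hx
    exact (restrict_of_mem (X := J.sch v) h2 θ).trans (restrict_of_mem (X := J.sch w) h1 θ).symm
  root_scope := by rw [initial_at J.tree.root_mem_verts]
  size a R hR := by
    cases a with
    | aux v => simp [initial] at hR
    | main v =>
      by_cases hv : v ∈ J.tree.verts
      · rw [initial_main hv] at hR
        rw [← Option.some.inj hR]
        exact (DB.card_rel_le _).trans (Nat.le_self_pow two_ne_zero _)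
      · simp [initial, hv] at hR

/-- `Sol` does not constrain values outside the scopes, while solutions are defined on exactly
`Φ.vars`; hence the restriction. Every constraint is tested since each labels some vertex. -/
theorem mem_sol_initial {η : Asg Var U} :
    η ∈ Sol J.tree (initial J DB F home).mem ↔ restrict Φ.vars η ∈ solutions Φ DB := by
  have hiff : η ∈ Sol J.tree (initial J DB F home).mem ↔
      ∀ k, restrict (Φ.scope k) η ∈ DB.rel k := by
    constructor
    · intro h k
      obtain ⟨v, hv, rfl⟩ := J.covers k
      have := h v hv
      rwa [initial_at hv] at this
    · intro h v hv
      rw [initial_at hv]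
      exact h (J.con v)
  rw [hiff]
  constructor
  · intro h
    refine ⟨fun x => ?_, fun k => ?_⟩
    · by_cases hx : x ∈ Φ.vars
      · rw [restrict_of_mem hx]
        obtain ⟨k, -, hk⟩ := Finset.mem_biUnion.1 hx
        have := (DB.isOver k _ (h k) x).2 hk
        rw [restrict_of_mem hk] at this
        simp [this, hx]
      · simp [restrict_of_notMem hx, hx]
    · rw [restrict_restrict (Φ.scope_subset_vars k)]
      exact h k
  · intro h k
    rw [← restrict_restrict (Φ.scope_subset_vars k)]
    exact h.2 k

variable (hhome : ∀ i, home i ∈ J.tree.verts ∧ (F.f i).vars ⊆ J.sch (home i))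
include hhome

theorem eval_restrict_vars (η : Asg Var U) : F.eval (restrict Φ.vars η) = F.eval η := by
  refine Finset.sum_congr rfl fun i _ => ?_
  rw [WeightFn.eval_congr fun x hx =>
    restrict_of_mem (Φ.scope_subset_vars _ ((hhome i).2 hx)) η]

theorem Post.exists_answer [LinearOrder D] {B : ℕ} {N : Mem Var U D V}
    (hP : Post B J.tree (initial J DB F home).mem N) (O : Finset Var) :
    ∃ ans, Outputs J O N ans ∧ IsMaxAnswer Φ DB F O ans := by
  rcases hP.result with ⟨hempty, hres⟩ | ⟨η, hη, hmax, hres⟩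
  · refine ⟨none, hres, Set.eq_empty_iff_forall_notMem.2 fun θ hθ => ?_⟩
    refine Set.eq_empty_iff_forall_notMem.1 hempty θ (mem_sol_initial.2 ?_)
    rwa [hθ.1.restrict_eq]
  · have hsol := mem_sol_initial.1 hη
    refine ⟨some (restrict O (restrict Φ.vars η)), ⟨_, hsol.1, rfl, fun v hv => ?_⟩,
      ⟨_, hsol, rfl⟩, ?_⟩
    · obtain ⟨R, hR, hs, ht⟩ := hres v hv
      rw [initial_at hv] at hs ht
      refine ⟨R, hR, hs, ht.trans ?_⟩
      rw [EJoinTree.sch, restrict_restrict (Φ.scope_subset_vars _)]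
    · rintro ⟨θ, -, -, h⟩
      -- A globally best solution witnesses that its restriction to `O` is at least as good as any
      -- `θ`, so none is strictly better.
      refine h ⟨_, hsol, rfl, fun ζ hζ _ => ?_⟩
      have := hmax ζ (mem_sol_initial.2 (by rwa [hζ.1.restrict_eq]))
      rwa [totalWeight_initial hhome, totalWeight_initial hhome, ← eval_restrict_vars hhome η]
        at this

end Initial

end DBMax

theorem mainTheorem12 :
    ∃ C : ℕ,
      ∀ (Var K V : Type*) [Fintype K] (Φ : DBMax.Formula Var K) (J : DBMax.EJoinTree Φ V)
        (c : ℕ), 1 ≤ c →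
      -- the program depends only on the tree, the scopes and the number of processors
      ∃ prog : List (DBMax.Instr V),
        prog.length ≤
          4 * (⌈Real.logb 2 (c : ℝ)⌉₊ + 2 * ⌈(J.tree.size : ℝ) / (4 * (c : ℝ))⌉₊) ∧
        ∀ (U D : Type*) [AddCommSemigroup D] [LinearOrder D],
          -- the operator on the weights distributes over the maximum
          (∀ a b b' : D, a + max b b' = max (a + b) (a + b')) →
          ∀ (DB : DBMax.Database Φ U), DBMax.GloballyConsistent Φ DB →
          -- each weight function is attached to a vertex whose scope contains its variables
          ∀ (F : DBMax.Valuation Var U D) (home : Fin F.m → V),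
          (∀ i, home i ∈ J.tree.verts ∧ (F.f i).vars ⊆ J.sch (home i)) →
          ∃ (tr : List (DBMax.Config Var U D V)) (τ : DBMax.Config Var U D V),
            DBMax.Run c J.sch (DBMax.initial J DB F home) prog tr τ ∧
            (∀ O : Finset Var, O ⊆ Φ.vars →
              ∃ ans, DBMax.Outputs J O τ.mem ans ∧ DBMax.IsMaxAnswer Φ DB F O ans) ∧
            (DBMax.storedRelations tr).encard ≤ ((C * J.tree.size : ℕ) : ℕ∞) ∧
            ∀ x ∈ DBMax.storedRelations tr, x.2.tuples.card ≤ C * DB.maxSize ^ 2 := by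
  -- The constant is `1 + 3`: one relation per vertex at the start and at most `3 * n` later writes.
  -- For the tuple bound the constant one would do.
  refine ⟨4, fun Var K V _ Φ J c hc => ?_⟩
  have hk : c ≤ 2 ^ ⌈Real.logb 2 (c : ℝ)⌉₊ := by
    have hc0 : (0 : ℝ) < c := by exact_mod_cast hc
    have h1 : (c : ℝ) ≤ 2 ^ ((⌈Real.logb 2 (c : ℝ)⌉₊ : ℕ) : ℝ) :=
      (Real.logb_le_iff_le_rpow one_lt_two hc0).1 (Nat.le_ceil _)
    rw [Real.rpow_natCast] at h1
    exact_mod_cast h1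
  have hm : J.tree.size ≤ 4 * c * ⌈(J.tree.size : ℝ) / (4 * (c : ℝ))⌉₊ := by
    have hc0 : (0 : ℝ) < 4 * c := by positivity
    have h1 := (div_le_iff₀' hc0).1 (Nat.le_ceil ((J.tree.size : ℝ) / (4 * (c : ℝ))))
    exact_mod_cast h1
  obtain ⟨oss, hS, hlen⟩ := DBMax.exists_schedule hc hk J.nodup hm
  refine ⟨DBMax.program oss, (DBMax.length_program oss).trans_le hlen, ?_⟩
  intro U D _ _ hD DB hDB F home hhome
  obtain ⟨tr, N, hrun, hP, ⟨S, hS', hsub⟩, hsize⟩ :=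
    DBMax.exists_run hD rfl hS (DBMax.good_initial (F := F) (home := home) hDB)
      (fun v _ => DB.card_rel_le _) []
  refine ⟨tr, _, hrun, fun O _ => hP.exists_answer hhome O, ?_, fun x hx => ?_⟩
  · calc _ ≤ (DBMax.initial J DB F home).mem.graph.encard + S.encard :=
          (Set.encard_le_encard hsub).trans (Set.encard_union_le _ _)
      _ ≤ (J.tree.size : ℕ∞) + (3 * J.tree.size : ℕ) :=
          add_le_add DBMax.initial_graph_encard hS'
      _ = _ := by
          norm_cast
          omega
  · exact (hsize x hx).trans (Nat.le_mul_of_pos_left _ (by norm_num))
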